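/- **Setting (linear regression with feedback delayed by $\tau$).** Let $\mathcal D\subset\mathbb R^d$ be compact and convex and $\tau\ge 1$. At round $t=1,\dots,n$ nature reveals $A_t\in\mathbb R^{p\times d}$ with rows $a_{t,1},\dots,a_{t,p}$, the learner plays $x_t\in\mathcal D$, and then nature reveals the loss $f_{t-\tau+1}$ (if $t\ge\tau$), where $f_t(z)=\|A_tz-b_t\|_2^2$, $b_t\in\mathbb R^p$. Assume $\|a_{t,i}\|_1\le\alpha$ and $\|b_t\|_1\le\sigma$ for all $t\in[n]$, $i\in[p]$, and $\|z\|_1\le\chi$, $\|z\|_\infty\le\tilde R$ for all $z\in\mathcal D$. Write $\mathcal D_\infty=\{w\in\mathbb R^d:\|w\|_\infty\le\tilde R\}$, and let $G,L$ satisfy $\|A_t(w_1+w_2)-2b_t\|_1\le G$ and $2\|A_tw-b_t\|_2^2+2G^2\le L$ for all $t\in[n]$ and $w,w_1,w_2\in\mathcal D_\infty$; here $\alpha,\tilde R,G>0$. For $u_1,\dots,u_n\in\mathcal D$ put $\mathcal{TV}(u_{1:n})=\sum_{t=2}^n\|u_t-u_{t-1}\|_1$. **Algorithm.** One instance of ProDR.control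 keeps a copy of the algorithm FLH-ONS on $\mathcal D_\infty$, described below. When the instance predicts at round $t$ and its copy of FLH-ONS predicts $w_t$, it plays any $x_t\in\operatorname{argmin}_{x\in\mathcal D}\max_i|a_{t,i}^T(x-w_t)|$. Its loss is sent to FLH-ONS as $\ell_t(w)=f_t(w)+G\min_{x\in\mathcal D}\max_i|a_{t,i}^T(x-w)|$. The delayed algorithm keeps $\tau$ instances $0,\dots,\tau-1$; at time $t$ it first updates instance $(t-1)\bmod\tau$ with the loss of time $t-\tau$ (if $t>\tau$) and then predicts with this instance. FLH-ONS uses $e=\frac1{4L}$, $\gamma=2G\alpha\tilde R\sqrt{d/(8L)}+\sqrt{2L}$, $\zeta=\min\{\frac1{16G\alpha\tilde R\sqrt d},\frac1{4\gamma^2}\}$, $\eta=\frac1{2\gamma^2}$, $\beta=\frac12\min\{\frac1{4(2G\alpha)(2\tilde R\sqrt d)},\frac1{4L}\}$. In its $k$-th round (rounds numbered separately for each instance) it has experts $j=1,\dots,k$ with predictions $y_k^{(j)}\in\mathcal D_\infty$ and weights $v_k^{(j)}$, where $v_1^{(1)}=1$, and predicts $w=\sum_{j\le k}v_k^{(j)}y_k^{(j)}$.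 After receiving the loss $\ell$ of this round it takes any subgradient $g$ of $\ell$ at $w$ and forms $h(y)=\bigl(\sqrt{e/2}\,g^T(y-w)+1/\sqrt{2e}\bigr)^2$. The weights become $v_{k+1}^{(j)}=\bigl(1-\tfrac1{k+1}\bigr)v_k^{(j)}e^{-\eta h(y_k^{(j)})}\big/\sum_{i\le k}v_k^{(i)}e^{-\eta h(y_k^{(i)})}$ for $j\le k$ and $v_{k+1}^{(k+1)}=\tfrac1{k+1}$. Expert $j$ is an Online Newton Step learner started in round $j$ with $y_j^{(j)}=0$ and matrix $\zeta I$; for $j\le k$ it adds $\nabla\nabla^T$, $\nabla=\nabla h(y_k^{(j)})$, to its matrix, giving $M$, and moves to $y_{k+1}^{(j)}=\operatorname{argmin}_{y\in\mathcal D_\infty}\|y_k^{(j)}-\tfrac1\beta M^{-1}\nabla-y\|_M$, with $\|v\|_M=\sqrt{v^TMv}$. **Theorem.** There are constants $C>0$ and $k\in\mathbb N$, depending only on $\alpha,\tilde R,G,L$, such that for all $d,p,\tau\ge1$, $n\ge2$, $\sigma$, $\chi$, $\mathcal D$, $(A_t,b_t)_{t\le n}$ as above and all predictions $x_1,\dots,x_n$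 of the delayed algorithm: $$\sum_{t=1}^n f_t(x_t)-f_t(u_t)\ \le\ C(\log n)^k\, d^3\max\bigl\{\tau^{2/3}n^{1/3}[\mathcal{TV}(u_{1:n})]^{2/3},\ \tau\bigr\}\qquad\text{for all }u_1,\dots,u_n\in\mathcal D,$$ $$\sum_{t=a}^b f_t(x_t)-f_t(u)\ \le\ C\,d^{3/2}\,\tau\,\log n\qquad\text{for all intervals }[a,b]\subseteq[n]\text{ and all }u\in\mathcal D.$$ -/

import Mathlib

open scoped Matrix

noncomputable section

namespace ProDR

/-- The norm `‖x‖₁`. -/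
def l1Norm {ι : Type*} [Fintype ι] (x : ι → ℝ) : ℝ := ∑ i, |x i|

/-- The box `{x : ‖x‖_∞ ≤ R}`. -/
def box (d : ℕ) (R : ℝ) : Set (Fin d → ℝ) := {x | ∀ i, |x i| ≤ R}

/-- `z` is a minimizer of `f` over `D`. -/
def IsArgmin {d : ℕ} (f : (Fin d → ℝ) → ℝ) (D : Set (Fin d → ℝ)) (z : Fin d → ℝ) : Prop :=
  z ∈ D ∧ IsMinOn f D z

/-- `g` is a subgradient at `x` of the function `f` on `ℝ^d`. -/
def IsSubgradient {d : ℕ} (f : (Fin d → ℝ) → ℝ) (x g : Fin d → ℝ) : Prop :=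
  ∀ y, f x + g ⬝ᵥ (y - x) ≤ f y

/-- The path variation `∑_{t=2}^n ‖u_t - u_{t-1}‖₁`. -/
def totalVariation {d : ℕ} (n : ℕ) (u : ℕ → Fin d → ℝ) : ℝ :=
  ∑ t ∈ Finset.Icc 2 n, l1Norm (u t - u (t - 1))

/-! ### Losses -/

/-- The regression loss `f(z) = ‖A z - b‖₂²`. -/
def regressionLoss {p d : ℕ} (A : Matrix (Fin p) (Fin d) ℝ) (b : Fin p → ℝ)
    (z : Fin d → ℝ) : ℝ :=
  ∑ i, ((A *ᵥ z) i - b i) ^ 2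

/-- `max_i |a_iᵀ (x - w)|`, where `a_i` are the rows of `A`. -/
def rowGap {p d : ℕ} (A : Matrix (Fin p) (Fin d) ℝ) (x w : Fin d → ℝ) : ℝ :=
  ⨆ i, |(A *ᵥ (x - w)) i|

/-- The barrier `S(w) = min_{x ∈ D} max_i |a_iᵀ (x - w)|`. -/
def barrier {p d : ℕ} (D : Set (Fin d → ℝ)) (A : Matrix (Fin p) (Fin d) ℝ)
    (w : Fin d → ℝ) : ℝ :=
  sInf ((fun x => rowGap A x w) '' D)

/-- The loss `ℓ(w) = f(w) + G · S(w)` sent to the surrogate algorithm. -/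
def penalizedLoss {p d : ℕ} (D : Set (Fin d → ℝ)) (G : ℝ) (A : Matrix (Fin p) (Fin d) ℝ)
    (b : Fin p → ℝ) (w : Fin d → ℝ) : ℝ :=
  regressionLoss A b w + G * barrier D A w

/-! ### Parameters -/

/-- The constants from which all tuning parameters are computed: the bound `alpha` on the
`ℓ¹` norms of the covariate rows, the box radius `R`, the penalty level `G`, the bound `L`. -/
structure Params where
  alpha : ℝ
  R : ℝ
  G : ℝ
  L : ℝ

/-- The exp-concavity parameter `1 / (4 L)` of the losses `ℓ_t` on the box. -/
def Params.expConcavity (P : Params) : ℝ := 1 / (4 * P.L)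

/-- `γ = 2 G α R √(d / (8 L)) + √(2 L)`. -/
def Params.gamma (P : Params) (d : ℕ) : ℝ :=
  2 * P.G * P.alpha * P.R * √((d : ℝ) / (8 * P.L)) + √(2 * P.L)

/-- `ζ = min {1 / (16 G α R √d), 1 / (4 γ²)}`, the regularization of ONS. -/
def Params.zeta (P : Params) (d : ℕ) : ℝ :=
  min (1 / (16 * P.G * P.alpha * P.R * √(d : ℝ))) (1 / (4 * P.gamma d ^ 2))

/-- `η = 1 / (2 γ²)`, the learning rate of FLH. -/
def Params.eta (P : Params) (d : ℕ) : ℝ := 1 / (2 * P.gamma d ^ 2)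

/-- The step parameter `β` of ONS in its standard tuning
`(1/2) min {1 / (4 · Lipschitz constant · diameter), exp-concavity}`: the losses `ℓ_t` are
`2 G α`-Lipschitz and the box has Euclidean diameter `2 R √d`. -/
def Params.beta (P : Params) (d : ℕ) : ℝ :=
  1 / 2 * min (1 / (4 * (2 * P.G * P.alpha) * (2 * P.R * √(d : ℝ)))) P.expConcavity

/-! ### The surrogate algorithm: FLH over ONS experts on the box -/

/-- The affine function `√(e/2) gᵀ (x - w) + 1 / √(2e)`. -/
def surrogateRoot {d : ℕ} (e : ℝ) (g w x : Fin d → ℝ) : ℝ :=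
  √(e / 2) * (g ⬝ᵥ (x - w)) + 1 / √(2 * e)

/-- The quadratic surrogate `(√(e/2) gᵀ (x - w) + 1 / √(2e))²` of an `e`-exp-concave loss that
has the subgradient `g` at the prediction `w`. -/
def surrogateLoss {d : ℕ} (e : ℝ) (g w x : Fin d → ℝ) : ℝ := surrogateRoot e g w x ^ 2

/-- The gradient of `surrogateLoss e g w` at `x`. -/
def surrogateGrad {d : ℕ} (e : ℝ) (g w x : Fin d → ℝ) : Fin d → ℝ :=
  (2 * surrogateRoot e g w x * √(e / 2)) • g

/-- The norm `‖v‖_M = √(vᵀ M v)`. -/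
def weightedNorm {d : ℕ} (M : Matrix (Fin d) (Fin d) ℝ) (v : Fin d → ℝ) : ℝ :=
  √(v ⬝ᵥ (M *ᵥ v))

/-- State of one copy of FLH-ONS: the current local round `t` (rounds start at `1`) and, for the
experts `j = 1, …, t` (expert `j` is the ONS instance that starts in round `j`), the FLH weight
`v_t^{(j)}`, the prediction `x_t^{(j)}`, and the ONS matrix `ζ I + ∑ ∇ ∇ᵀ` accumulated so far. -/
structure State (d : ℕ) where
  round : ℕ
  weight : ℕ → ℝ
  expert : ℕ → Fin d → ℝ
  mat : ℕ → Matrix (Fin d) (Fin d) ℝ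

/-- Before the first local round: a single expert, of weight `1`, predicting `0`. -/
def State.init {d : ℕ} (P : Params) : State d where
  round := 1
  weight := fun j => if j = 1 then 1 else 0
  expert := fun _ => 0
  mat := fun _ => P.zeta d • (1 : Matrix (Fin d) (Fin d) ℝ)

/-- The FLH prediction `∑_{j ≤ t} v_t^{(j)} x_t^{(j)}`. -/
def State.predict {d : ℕ} (s : State d) : Fin d → ℝ :=
  ∑ j ∈ Finset.Icc 1 s.round, s.weight j • s.expert j

/-- One round of FLH-ONS: from the state `s`, after the loss of the current round has revealed its
subgradient `g` at the prediction `s.predict`, to the state `s'` of the next round. -/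
structure FLHStep {d : ℕ} (P : Params) (s : State d) (g : Fin d → ℝ) (s' : State d) : Prop where
  round_eq : s'.round = s.round + 1
  /-- exponential reweighting of the old experts, scaled by `1 - 1/(t+1)` -/
  weight_old : ∀ i ∈ Finset.Icc 1 s.round, s'.weight i =
    (1 - 1 / ((s.round : ℝ) + 1)) *
      (s.weight i * Real.exp
          (-(P.eta d) * surrogateLoss P.expConcavity g s.predict (s.expert i)) /
        ∑ j ∈ Finset.Icc 1 s.round, s.weight j * Real.exp
          (-(P.eta d) * surrogateLoss P.expConcavity g s.predict (s.expert j)))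
  /-- the weight of the new expert -/
  weight_new : s'.weight (s.round + 1) = 1 / ((s.round : ℝ) + 1)
  /-- every old expert adds `∇ ∇ᵀ`, its own gradient of the surrogate loss -/
  mat_old : ∀ j ∈ Finset.Icc 1 s.round, s'.mat j = s.mat j +
    Matrix.vecMulVec (surrogateGrad P.expConcavity g s.predict (s.expert j))
      (surrogateGrad P.expConcavity g s.predict (s.expert j))
  /-- and makes a projected Newton step -/
  expert_old : ∀ j ∈ Finset.Icc 1 s.round, IsArgmin
    (fun x => weightedNorm (s'.mat j)
      (s.expert j - (1 / P.beta d) •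
        ((s'.mat j)⁻¹ *ᵥ surrogateGrad P.expConcavity g s.predict (s.expert j)) - x))
    (box d P.R) (s'.expert j)
  /-- the new expert starts from `0` -/
  mat_new : s'.mat (s.round + 1) = P.zeta d • (1 : Matrix (Fin d) (Fin d) ℝ)
  expert_new : s'.expert (s.round + 1) = 0

/-! ### ProDR.control and its delayed version -/

/-- `z` is a legitimate play of an instance of ProDR.control with internal state `s` that receives
the covariates `A`. -/
def Plays {p d : ℕ} (D : Set (Fin d → ℝ)) (A : Matrix (Fin p) (Fin d) ℝ) (s : State d)
    (z : Fin d → ℝ) : Prop :=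
  IsArgmin (fun x => rowGap A x s.predict) D z

/-- An instance of ProDR.control in the state `s` is updated with the loss given by `(A, b)` and
arrives in the state `s'`. -/
def Update {p d : ℕ} (D : Set (Fin d → ℝ)) (P : Params) (A : Matrix (Fin p) (Fin d) ℝ)
    (b : Fin p → ℝ) (s s' : State d) : Prop :=
  ∃ g, IsSubgradient (penalizedLoss D P.G A b) s.predict g ∧ FLHStep P s g s'

/-- `x 1, …, x n` are predictions of ProDR.control.delayed with delay `τ`, and `S t i` is the
state in which instance `i ∈ {0, …, τ - 1}` is at the end of time `t`. At time `t`, instance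
`(t - 1) mod τ` is first updated with the loss of time `t - τ` (if there is one) and then
predicts. -/
structure DelayedRun {p d : ℕ} (D : Set (Fin d → ℝ)) (P : Params) (τ n : ℕ)
    (A : ℕ → Matrix (Fin p) (Fin d) ℝ) (b : ℕ → Fin p → ℝ)
    (S : ℕ → ℕ → State d) (x : ℕ → Fin d → ℝ) : Prop where
  init : ∀ i < τ, S 0 i = State.init P
  idle : ∀ t ∈ Finset.Icc 1 n, ∀ i < τ, i ≠ (t - 1) % τ → S t i = S (t - 1) i
  first : ∀ t ∈ Finset.Icc 1 n, t ≤ τ → S t ((t - 1) % τ) = S (t - 1) ((t - 1) % τ)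
  update : ∀ t ∈ Finset.Icc 1 n, τ < t →
    Update D P (A (t - τ)) (b (t - τ)) (S (t - 1) ((t - 1) % τ)) (S t ((t - 1) % τ))
  play : ∀ t ∈ Finset.Icc 1 n, Plays D (A t) (S t ((t - 1) % τ)) (x t)

end ProDR

end

/-!
The proof has three parts.

*Reduction to quadratic surrogates.* The barrier is convex and `1`-Lipschitz in the seminorm
`max_i |a_iᵀ v|`. Hence a subgradient `g` of the penalized loss at a point `w` of the box satisfies
`‖g‖₁ ≤ 2 G α` and `|gᵀ (y - w)| ≤ 2 G² ≤ L` on the box, and the quadratic part `‖A (u - w)‖²` of the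
loss dominates `(e / 2) (gᵀ (u - w))²` with `e = 1 / (4 L)`. Since a play `x` has at most the
penalized loss of `w`, the regret `f(x) - f(u)` is at most
`surrogateRegret e g w u = gᵀ (w - u) - (e / 2) (gᵀ (w - u))²`
(`DataBounds.regret_le_surrogateRegret`).

*Interval regret on the box.* In terms of `z = gᵀ (y - w)` the surrogate loss is
`2 L + z + (e / 2) z²`, and its gradient is `(1 + e z) g`. The weights of FLH are controlled by the
tangent bound `exp (-η (z + e z² / 2)) ≤ 1 - η z`, which holds on the whole range of `z`; the experts
by the usual analysis of Online Newton Step. Both fit into one potential for each expert, which drops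
in every round by at least the surrogate regret against any fixed point of the box
(`FLHStep.surrogateRegret_le`). Telescoping with shift `τ` over the interleaved instances bounds the
surrogate regret on every interval of time by `O(d^{3/2} τ log n)` (`Interleaved.sum_Ico_le`).
The feedback of the last `τ` rounds is never used; these rounds cost `L / 2` each.

*Moving comparators.* Divide `[-R, R]` by a grid of mesh `δ = R / N`, and round the coordinates of
`u_t` to the grid after adding one random shift, uniform on `[0, δ]` and the same for all `t`. The
rounded sequence `v_t` stays in the box, has mean `u_t`, and has at most `TV / δ` switches in
expectation. The surrogates are quadratic, so that on average only their second order terms, of size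
`O(δ²)`, separate the regret against `u` from that against `v`; the latter is the sum of interval
regrets over the constant pieces of `v` (`Interleaved.sum_le_totalVariation`). Choosing
`δ ≈ (τ TV / n)^{1/3}` balances `n δ²` and `τ TV / δ`, with a single factor `log n`.
-/

namespace ProDR

/-! ### The regression loss, the barrier and their subgradients -/

/-- All constants from which the tuning parameters are computed are positive. -/
structure Params.Pos (P : Params) : Prop where
  alpha : 0 < P.alpha
  R : 0 < P.R
  G : 0 < P.G
  L : 0 < P.L

/-- The bounds that the theorem assumes on the data `(A, b)` of a single round. -/
structure DataBounds {p d : ℕ} (P : Params) (A : Matrix (Fin p) (Fin d) ℝ)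
    (b : Fin p → ℝ) : Prop where
  row : ∀ i, l1Norm (A i) ≤ P.alpha
  sum_bound : ∀ w₁ ∈ box d P.R, ∀ w₂ ∈ box d P.R,
    l1Norm (A *ᵥ (w₁ + w₂) - (2 : ℝ) • b) ≤ P.G
  loss_bound : ∀ w ∈ box d P.R, 2 * regressionLoss A b w + 2 * P.G ^ 2 ≤ P.L

lemma l1Norm_nonneg {ι : Type*} [Fintype ι] (x : ι → ℝ) : 0 ≤ l1Norm x :=
  Finset.sum_nonneg fun _ _ => abs_nonneg _

lemma abs_le_l1Norm {ι : Type*} [Fintype ι] (x : ι → ℝ) (i : ι) : |x i| ≤ l1Norm x :=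
  Finset.single_le_sum (f := fun i => |x i|) (fun _ _ => abs_nonneg _) (Finset.mem_univ i)

lemma abs_dotProduct_le {ι : Type*} [Fintype ι] (g z : ι → ℝ) {r : ℝ} (hz : ∀ i, |z i| ≤ r) :
    |g ⬝ᵥ z| ≤ l1Norm g * r := by
  unfold dotProduct l1Norm
  rw [Finset.sum_mul]
  refine (Finset.abs_sum_le_sum_abs _ _).trans (Finset.sum_le_sum fun i _ => ?_)
  rw [abs_mul]
  exact mul_le_mul_of_nonneg_left (hz i) (abs_nonneg _)

lemma convex_box (d : ℕ) (R : ℝ) : Convex ℝ (box d R) := by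
  intro x hx y hy a c ha hc hac i
  simp only [Pi.add_apply, Pi.smul_apply, smul_eq_mul]
  calc |a * x i + c * y i| ≤ |a * x i| + |c * y i| := abs_add_le _ _
    _ = a * |x i| + c * |y i| := by rw [abs_mul, abs_mul, abs_of_nonneg ha, abs_of_nonneg hc]
    _ ≤ a * R + c * R := by gcongr <;> [exact hx i; exact hy i]
    _ = R := by rw [← add_mul, hac, one_mul]

lemma zero_mem_box {d : ℕ} {R : ℝ} (hR : 0 ≤ R) : (0 : Fin d → ℝ) ∈ box d R :=
  fun i => by simpa using hR

lemma regressionLoss_nonneg {p d : ℕ} (A : Matrix (Fin p) (Fin d) ℝ) (b : Fin p → ℝ)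
    (z : Fin d → ℝ) : 0 ≤ regressionLoss A b z :=
  Finset.sum_nonneg fun _ _ => sq_nonneg _

section Barrier

variable {p d : ℕ} {D : Set (Fin d → ℝ)} {A : Matrix (Fin p) (Fin d) ℝ} {b : Fin p → ℝ}

lemma abs_mulVec_le_rowGap (A : Matrix (Fin p) (Fin d) ℝ) (x w : Fin d → ℝ) (i : Fin p) :
    |(A *ᵥ (x - w)) i| ≤ rowGap A x w :=
  le_ciSup (f := fun i => |(A *ᵥ (x - w)) i|) (Set.finite_range _).bddAbove i

lemma rowGap_le {x w : Fin d → ℝ} {c : ℝ} (hc : 0 ≤ c) (h : ∀ i, |(A *ᵥ (x - w)) i| ≤ c) :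
    rowGap A x w ≤ c := Real.iSup_le h hc

lemma rowGap_nonneg (x w : Fin d → ℝ) : 0 ≤ rowGap A x w :=
  Real.iSup_nonneg fun _ => abs_nonneg _

lemma barrier_le_rowGap {x : Fin d → ℝ} (hx : x ∈ D) (w : Fin d → ℝ) :
    barrier D A w ≤ rowGap A x w :=
  csInf_le ⟨0, by rintro _ ⟨y, _, rfl⟩; exact rowGap_nonneg y w⟩ ⟨x, hx, rfl⟩

lemma barrier_nonpos {u : Fin d → ℝ} (hu : u ∈ D) : barrier D A u ≤ 0 :=
  (barrier_le_rowGap hu u).trans (rowGap_le le_rfl fun i => by simp)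

lemma rowGap_le_barrier {x w : Fin d → ℝ} (hx : IsArgmin (fun x => rowGap A x w) D x) :
    rowGap A x w ≤ barrier D A w :=
  le_csInf ⟨_, x, hx.1, rfl⟩ (by rintro _ ⟨y, hy, rfl⟩; exact hx.2 hy)

/-- The barrier is `1`-Lipschitz in the seminorm `max_i |a_iᵀ v|`. -/
lemma barrier_le_add (hD : D.Nonempty) {w w' : Fin d → ℝ} {c : ℝ} (hc : 0 ≤ c)
    (h : ∀ i, |(A *ᵥ (w' - w)) i| ≤ c) : barrier D A w' ≤ barrier D A w + c := by
  rw [← sub_le_iff_le_add]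
  refine le_csInf (hD.image _) ?_
  rintro _ ⟨x, hx, rfl⟩
  rw [sub_le_iff_le_add]
  refine (barrier_le_rowGap hx w').trans
    (rowGap_le (add_nonneg (rowGap_nonneg x w) hc) fun i => ?_)
  have e : (A *ᵥ (x - w')) i = (A *ᵥ (x - w)) i - (A *ᵥ (w' - w)) i := by
    simp only [Matrix.mulVec_sub, Pi.sub_apply]; ring
  rw [e]
  exact (abs_sub _ _).trans (add_le_add (abs_mulVec_le_rowGap A x w i) (h i))

/-- The barrier is convex, as a partial minimum of a jointly convex function. -/
lemma barrier_convex (hD : D.Nonempty) (hconv : Convex ℝ D) (w v : Fin d → ℝ) {s : ℝ}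
    (h0 : 0 ≤ s) (h1 : s ≤ 1) :
    barrier D A (w + s • v) ≤ (1 - s) * barrier D A w + s * barrier D A (w + v) := by
  refine le_of_forall_pos_le_add fun ε hε => ?_
  obtain ⟨_, ⟨x, hx, rfl⟩, hxε⟩ :=
    exists_lt_of_csInf_lt (hD.image (fun x => rowGap A x w)) (lt_add_of_pos_right (barrier D A w) hε)
  obtain ⟨_, ⟨y, hy, rfl⟩, hyε⟩ :=
    exists_lt_of_csInf_lt (hD.image (fun x => rowGap A x (w + v)))
      (lt_add_of_pos_right (barrier D A (w + v)) hε)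
  have hz : (1 - s) • x + s • y ∈ D := hconv hx hy (by linarith) h0 (by ring)
  have h1s : 0 ≤ 1 - s := by linarith
  calc barrier D A (w + s • v) ≤ rowGap A ((1 - s) • x + s • y) (w + s • v) :=
        barrier_le_rowGap hz _
    _ ≤ (1 - s) * rowGap A x w + s * rowGap A y (w + v) := by
        refine rowGap_le (add_nonneg (mul_nonneg h1s (rowGap_nonneg _ _))
          (mul_nonneg h0 (rowGap_nonneg _ _))) fun i => ?_
        have e : (A *ᵥ ((1 - s) • x + s • y - (w + s • v))) i =
            (1 - s) * (A *ᵥ (x - w)) i + s * (A *ᵥ (y - (w + v))) i := by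
          simp only [Matrix.mulVec_sub, Matrix.mulVec_add, Matrix.mulVec_smul, Pi.sub_apply,
            Pi.add_apply, Pi.smul_apply, smul_eq_mul]
          ring
        rw [e]
        refine (abs_add_le _ _).trans ?_
        rw [abs_mul, abs_mul, abs_of_nonneg h1s, abs_of_nonneg h0]
        exact add_le_add (mul_le_mul_of_nonneg_left (abs_mulVec_le_rowGap A x w i) h1s)
          (mul_le_mul_of_nonneg_left (abs_mulVec_le_rowGap A y (w + v) i) h0)
    _ ≤ (1 - s) * (barrier D A w + ε) + s * (barrier D A (w + v) + ε) := by gcongr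
    _ = _ := by ring

/-- The directional derivative of `regressionLoss A b` at `w` along `v`. -/
noncomputable def lossDeriv (A : Matrix (Fin p) (Fin d) ℝ) (b : Fin p → ℝ) (w v : Fin d → ℝ) : ℝ :=
  ∑ i, 2 * ((A *ᵥ w) i - b i) * (A *ᵥ v) i

lemma regressionLoss_add_smul (w v : Fin d → ℝ) (s : ℝ) :
    regressionLoss A b (w + s • v) =
      regressionLoss A b w + s * lossDeriv A b w v + s ^ 2 * ∑ i, (A *ᵥ v) i ^ 2 := by
  simp only [regressionLoss, lossDeriv, Finset.mul_sum, ← Finset.sum_add_distrib]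
  refine Finset.sum_congr rfl fun i _ => ?_
  simp only [Matrix.mulVec_add, Matrix.mulVec_smul, Pi.add_apply, Pi.smul_apply, smul_eq_mul]
  ring

/-- A subgradient of the penalized loss splits as the gradient of the regression loss plus a
subgradient of the barrier. -/
lemma IsSubgradient.dotProduct_le {G : ℝ} (hG : 0 ≤ G) (hD : D.Nonempty) (hconv : Convex ℝ D)
    {w g : Fin d → ℝ} (hg : IsSubgradient (penalizedLoss D G A b) w g) (v : Fin d → ℝ) :
    g ⬝ᵥ v ≤ lossDeriv A b w v + G * (barrier D A (w + v) - barrier D A w) := by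
  set N := ∑ i, (A *ᵥ v) i ^ 2
  have key : ∀ s : ℝ, 0 < s → s ≤ 1 →
      g ⬝ᵥ v ≤ lossDeriv A b w v + G * (barrier D A (w + v) - barrier D A w) + s * N := by
    intro s hs hs1
    have h1 := hg (w + s • v)
    simp only [penalizedLoss, add_sub_cancel_left, dotProduct_smul, smul_eq_mul,
      regressionLoss_add_smul] at h1
    have h2 := mul_le_mul_of_nonneg_left
      (barrier_convex (A := A) hD hconv w v hs.le hs1) hG
    refine le_of_mul_le_mul_left (a := s) ?_ hs
    simp only [N]
    linear_combination h1 + h2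
  refine le_of_forall_pos_le_add fun ε hε => ?_
  have hN : 0 ≤ N := Finset.sum_nonneg fun _ _ => sq_nonneg _
  have hpos : 0 < min 1 (ε / (N + 1)) := lt_min one_pos (by positivity)
  refine (key _ hpos (min_le_left _ _)).trans ?_
  have : min 1 (ε / (N + 1)) * N ≤ ε :=
    calc min 1 (ε / (N + 1)) * N ≤ ε / (N + 1) * (N + 1) := by
          gcongr
          · exact min_le_right _ _
          · linarith
      _ = ε := div_mul_cancel₀ _ (by positivity)
  linarith

/-- The quadratic part of the regression loss survives in the subgradient inequality. -/
lemma IsSubgradient.quadratic_le {G : ℝ} (hG : 0 ≤ G) (hD : D.Nonempty) (hconv : Convex ℝ D)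
    {w g : Fin d → ℝ} (hg : IsSubgradient (penalizedLoss D G A b) w g) (u : Fin d → ℝ) :
    penalizedLoss D G A b w + g ⬝ᵥ (u - w) + ∑ i, (A *ᵥ (u - w)) i ^ 2 ≤
      penalizedLoss D G A b u := by
  have h := hg.dotProduct_le hG hD hconv (u - w)
  have h2 := regressionLoss_add_smul (A := A) (b := b) w (u - w) 1
  simp only [one_smul, add_sub_cancel] at h h2
  simp only [penalizedLoss]
  linarith

lemma IsSubgradient.abs_dotProduct_le {G : ℝ} (hG : 0 ≤ G) (hD : D.Nonempty)
    (hconv : Convex ℝ D) {w g : Fin d → ℝ}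
    (hg : IsSubgradient (penalizedLoss D G A b) w g) {v : Fin d → ℝ} {c : ℝ} (hc : 0 ≤ c)
    (hv : ∀ i, |(A *ᵥ v) i| ≤ c) :
    |g ⬝ᵥ v| ≤ ∑ i, |2 * ((A *ᵥ w) i - b i)| * |(A *ᵥ v) i| + G * c := by
  have key : ∀ v : Fin d → ℝ, (∀ i, |(A *ᵥ v) i| ≤ c) →
      g ⬝ᵥ v ≤ ∑ i, |2 * ((A *ᵥ w) i - b i)| * |(A *ᵥ v) i| + G * c := by
    intro v hv
    have h := hg.dotProduct_le hG hD hconv v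
    have h1 : barrier D A (w + v) ≤ barrier D A w + c :=
      barrier_le_add hD hc (by simpa using hv)
    have h2 : lossDeriv A b w v ≤ ∑ i, |2 * ((A *ᵥ w) i - b i)| * |(A *ᵥ v) i| :=
      Finset.sum_le_sum fun i _ => by rw [← abs_mul]; exact le_abs_self _
    have h3 : G * (barrier D A (w + v) - barrier D A w) ≤ G * c :=
      mul_le_mul_of_nonneg_left (by linarith) hG
    linarith
  refine abs_le.2 ⟨?_, key v hv⟩
  have h := key (-v) (by simpa [Matrix.mulVec_neg] using hv)
  simp only [Matrix.mulVec_neg, Pi.neg_apply, abs_neg, dotProduct_neg] at h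
  linarith

end Barrier

section Bounds

variable {p d : ℕ} {D : Set (Fin d → ℝ)} {P : Params} {A : Matrix (Fin p) (Fin d) ℝ}
  {b : Fin p → ℝ} {w g : Fin d → ℝ}

lemma DataBounds.two_mul_sq_le (h : DataBounds P A b) (hR : 0 ≤ P.R) : 2 * P.G ^ 2 ≤ P.L := by
  have := h.loss_bound 0 (zero_mem_box hR)
  have := regressionLoss_nonneg A b 0
  linarith

lemma DataBounds.sum_abs_le (h : DataBounds P A b) (hw : w ∈ box d P.R) :
    ∑ i, |2 * ((A *ᵥ w) i - b i)| ≤ P.G := by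
  refine le_trans (le_of_eq ?_) (h.sum_bound w hw w hw)
  refine Finset.sum_congr rfl fun i _ => ?_
  simp only [Matrix.mulVec_add, Pi.sub_apply, Pi.add_apply, Pi.smul_apply, smul_eq_mul]
  congr 1; ring

lemma DataBounds.l1Norm_subgradient_le (h : DataBounds P A b) (hP : P.Pos) (hD : D.Nonempty)
    (hconv : Convex ℝ D) (hw : w ∈ box d P.R)
    (hg : IsSubgradient (penalizedLoss D P.G A b) w g) :
    l1Norm g ≤ 2 * P.G * P.alpha := by
  set v : Fin d → ℝ := fun j => SignType.sign (g j)
  have hv1 : ∀ j, |v j| ≤ 1 := by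
    intro j
    rcases lt_trichotomy (g j) 0 with h | h | h <;> simp [v, h]
  have hv : ∀ i, |(A *ᵥ v) i| ≤ P.alpha := fun i =>
    (ProDR.abs_dotProduct_le (A i) v hv1).trans (by simpa using h.row i)
  have e : g ⬝ᵥ v = l1Norm g := Finset.sum_congr rfl fun j _ => by
    simp [v]
  have h1 := hg.abs_dotProduct_le hP.G.le hD hconv hP.alpha.le hv
  rw [e, abs_of_nonneg (l1Norm_nonneg g)] at h1
  have h2 : ∑ i, |2 * ((A *ᵥ w) i - b i)| * |(A *ᵥ v) i| ≤ P.G * P.alpha :=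
    calc _ ≤ ∑ i, |2 * ((A *ᵥ w) i - b i)| * P.alpha :=
          Finset.sum_le_sum fun i _ => mul_le_mul_of_nonneg_left (hv i) (abs_nonneg _)
      _ = (∑ i, |2 * ((A *ᵥ w) i - b i)|) * P.alpha := by rw [Finset.sum_mul]
      _ ≤ _ := mul_le_mul_of_nonneg_right (h.sum_abs_le hw) hP.alpha.le
  linarith

/-- On the box, `‖A (y - w)‖_∞ ≤ G`, hence `|gᵀ (y - w)| ≤ 2 G² ≤ L`. -/
lemma DataBounds.abs_subgradient_dotProduct_le (h : DataBounds P A b) (hP : P.Pos)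
    (hD : D.Nonempty) (hconv : Convex ℝ D) (hw : w ∈ box d P.R)
    (hg : IsSubgradient (penalizedLoss D P.G A b) w g) {y : Fin d → ℝ} (hy : y ∈ box d P.R) :
    |g ⬝ᵥ (y - w)| ≤ P.L := by
  have hv : ∀ i, |(A *ᵥ (y - w)) i| ≤ P.G := by
    intro i
    have h1 := (abs_le_l1Norm _ i).trans (h.sum_bound y hy y hy)
    have h2 := (abs_le_l1Norm _ i).trans (h.sum_bound w hw w hw)
    simp only [Matrix.mulVec_add, Matrix.mulVec_sub, Pi.sub_apply, Pi.add_apply, Pi.smul_apply,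
      smul_eq_mul] at h1 h2 ⊢
    rw [abs_le] at h1 h2 ⊢
    constructor <;> linarith [h1.1, h1.2, h2.1, h2.2]
  refine (hg.abs_dotProduct_le hP.G.le hD hconv hP.G.le hv).trans ?_
  have h2 : ∑ i, |2 * ((A *ᵥ w) i - b i)| * |(A *ᵥ (y - w)) i| ≤ P.G * P.G :=
    calc _ ≤ ∑ i, |2 * ((A *ᵥ w) i - b i)| * P.G :=
          Finset.sum_le_sum fun i _ => mul_le_mul_of_nonneg_left (hv i) (abs_nonneg _)
      _ = (∑ i, |2 * ((A *ᵥ w) i - b i)|) * P.G := by rw [Finset.sum_mul]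
      _ ≤ _ := mul_le_mul_of_nonneg_right (h.sum_abs_le hw) hP.G.le
  have := h.two_mul_sq_le hP.R.le
  nlinarith

/-- The regret of `w` against `u` in the quadratic surrogate loss:
`surrogateLoss e g w w - surrogateLoss e g w u`. -/
noncomputable def surrogateRegret {d : ℕ} (e : ℝ) (g w u : Fin d → ℝ) : ℝ :=
  g ⬝ᵥ (w - u) - e / 2 * (g ⬝ᵥ (w - u)) ^ 2

/-- The quadratic part `‖A (u - w)‖²` dominates the second order term of the surrogate, because
`|gᵀ v| ≤ (2 ‖A w - b‖₂ + G) ‖A v‖₂` and `(2 ‖A w - b‖₂ + G)² ≤ 4 L`. -/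
lemma DataBounds.expConcavity_mul_sq_le (h : DataBounds P A b) (hP : P.Pos)
    (hD : D.Nonempty) (hconv : Convex ℝ D) (hw : w ∈ box d P.R)
    (hg : IsSubgradient (penalizedLoss D P.G A b) w g) (v : Fin d → ℝ) :
    P.expConcavity / 2 * (g ⬝ᵥ v) ^ 2 ≤ ∑ i, (A *ᵥ v) i ^ 2 := by
  set N := ∑ i, (A *ᵥ v) i ^ 2 with hN
  have hN0 : 0 ≤ N := Finset.sum_nonneg fun _ _ => sq_nonneg _
  set F := regressionLoss A b w
  have hF0 : 0 ≤ F := regressionLoss_nonneg A b w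
  have hv : ∀ i, |(A *ᵥ v) i| ≤ √N := fun i =>
    Real.abs_le_sqrt (Finset.single_le_sum (f := fun i => (A *ᵥ v) i ^ 2)
      (fun _ _ => sq_nonneg _) (Finset.mem_univ i))
  have h1 := hg.abs_dotProduct_le hP.G.le hD hconv (Real.sqrt_nonneg N) hv
  have h2 : ∑ i, |2 * ((A *ᵥ w) i - b i)| * |(A *ᵥ v) i| ≤ 2 * √F * √N := by
    have := Real.sum_mul_le_sqrt_mul_sqrt Finset.univ (fun i => |(A *ᵥ w) i - b i|)
      (fun i => |(A *ᵥ v) i|)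
    simp only [sq_abs] at this
    calc _ = 2 * ∑ i, |(A *ᵥ w) i - b i| * |(A *ᵥ v) i| := by
          rw [Finset.mul_sum]
          refine Finset.sum_congr rfl fun i _ => ?_
          rw [abs_mul, abs_two, mul_assoc]
      _ ≤ 2 * (√F * √N) := by gcongr; exact this
      _ = _ := by ring
  have h3 : |g ⬝ᵥ v| ≤ (2 * √F + P.G) * √N := by linarith
  have hLb : 2 * F + 2 * P.G ^ 2 ≤ P.L := h.loss_bound w hw
  have h4 : (g ⬝ᵥ v) ^ 2 ≤ 4 * P.L * N := by
    calc (g ⬝ᵥ v) ^ 2 = |g ⬝ᵥ v| ^ 2 := (sq_abs _).symm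
      _ ≤ ((2 * √F + P.G) * √N) ^ 2 := by gcongr
      _ = (2 * √F + P.G) ^ 2 * N := by rw [mul_pow, Real.sq_sqrt hN0]
      _ ≤ (4 * P.L) * N := by
          gcongr
          have := Real.sq_sqrt hF0
          nlinarith [sq_nonneg (2 * √F - P.G), hP.G, hP.L]
  have hL := hP.L
  unfold Params.expConcavity
  calc 1 / (4 * P.L) / 2 * (g ⬝ᵥ v) ^ 2 ≤ 1 / (4 * P.L) / 2 * (4 * P.L * N) := by gcongr
    _ = N / 2 := by field_simp
    _ ≤ N := by linarith

/-- A play `x` at the surrogate prediction `w` has at most the penalized loss of `w`: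
`f(x) - f(w) = ∑ i, a_iᵀ(x - w) (a_iᵀ(x + w) - 2 b_i) ≤ G · S(w)`. -/
lemma DataBounds.regressionLoss_play_le (h : DataBounds P A b)
    (hDbox : D ⊆ box d P.R) (hw : w ∈ box d P.R) {x : Fin d → ℝ}
    (hx : IsArgmin (fun x => rowGap A x w) D x) :
    regressionLoss A b x ≤ penalizedLoss D P.G A b w := by
  have e : regressionLoss A b x - regressionLoss A b w =
      (A *ᵥ (x + w) - (2 : ℝ) • b) ⬝ᵥ (A *ᵥ (x - w)) := by
    simp only [regressionLoss, dotProduct, ← Finset.sum_sub_distrib]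
    refine Finset.sum_congr rfl fun i _ => ?_
    simp only [Matrix.mulVec_add, Matrix.mulVec_sub, Pi.sub_apply, Pi.add_apply, Pi.smul_apply,
      smul_eq_mul]
    ring
  have h1 := (le_abs_self _).trans
    (ProDR.abs_dotProduct_le (A *ᵥ (x + w) - (2 : ℝ) • b) _ (abs_mulVec_le_rowGap A x w))
  have h2 : l1Norm (A *ᵥ (x + w) - (2 : ℝ) • b) * rowGap A x w ≤ P.G * barrier D A w :=
    mul_le_mul (h.sum_bound x (hDbox hx.1) w hw) (rowGap_le_barrier hx) (rowGap_nonneg _ _)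
      ((l1Norm_nonneg _).trans (h.sum_bound w hw w hw))
  unfold penalizedLoss
  linarith

/-- The regret of a play in the regression loss is at most the surrogate regret. -/
lemma DataBounds.regret_le_surrogateRegret (h : DataBounds P A b) (hP : P.Pos)
    (hconv : Convex ℝ D) (hDbox : D ⊆ box d P.R) (hw : w ∈ box d P.R)
    (hg : IsSubgradient (penalizedLoss D P.G A b) w g) {x : Fin d → ℝ}
    (hx : IsArgmin (fun x => rowGap A x w) D x) {u : Fin d → ℝ} (hu : u ∈ D) :
    regressionLoss A b x - regressionLoss A b u ≤ surrogateRegret P.expConcavity g w u := by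
  have hD : D.Nonempty := ⟨u, hu⟩
  have h1 := h.regressionLoss_play_le hDbox hw hx
  have h2 := hg.quadratic_le hP.G.le hD hconv u
  have h3 := h.expConcavity_mul_sq_le hP hD hconv hw hg (u - w)
  have h4 : penalizedLoss D P.G A b u ≤ regressionLoss A b u := by
    have := mul_nonpos_of_nonneg_of_nonpos hP.G.le (barrier_nonpos (A := A) hu)
    unfold penalizedLoss; linarith
  have e : g ⬝ᵥ (w - u) = -(g ⬝ᵥ (u - w)) := by rw [← dotProduct_neg, neg_sub]
  unfold surrogateRegret
  rw [e, neg_sq]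
  linarith

end Bounds
/-! ### Quadratic forms, projections and log-determinants -/

section Quadratic

variable {d : ℕ}

/-- The quadratic form `vᵀ M v`. -/
def quadForm (M : Matrix (Fin d) (Fin d) ℝ) (v : Fin d → ℝ) : ℝ := v ⬝ᵥ (M *ᵥ v)

lemma quadForm_nonneg {M : Matrix (Fin d) (Fin d) ℝ} (hM : M.PosDef) (v : Fin d → ℝ) :
    0 ≤ quadForm M v := by
  have := hM.posSemidef.dotProduct_mulVec_nonneg v
  rwa [star_trivial] at this

lemma dotProduct_mulVec_symm {M : Matrix (Fin d) (Fin d) ℝ} (hM : M.PosDef)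
    (a c : Fin d → ℝ) : a ⬝ᵥ (M *ᵥ c) = c ⬝ᵥ (M *ᵥ a) := by
  have h : Mᵀ = M := by simpa [Matrix.IsHermitian] using hM.isHermitian
  rw [Matrix.dotProduct_mulVec, ← Matrix.mulVec_transpose, h, dotProduct_comm]

lemma quadForm_sub_smul {M : Matrix (Fin d) (Fin d) ℝ} (hM : M.PosDef) (a c : Fin d → ℝ)
    (s : ℝ) :
    quadForm M (a - s • c) = quadForm M a - 2 * s * (a ⬝ᵥ (M *ᵥ c)) + s ^ 2 * quadForm M c := by
  have := dotProduct_mulVec_symm hM a c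
  simp only [quadForm, Matrix.mulVec_sub, Matrix.mulVec_smul, dotProduct_sub, sub_dotProduct,
    smul_dotProduct, dotProduct_smul, smul_eq_mul]
  rw [← this]
  ring

lemma quadForm_add_vecMulVec (M : Matrix (Fin d) (Fin d) ℝ) (g v : Fin d → ℝ) :
    quadForm (M + Matrix.vecMulVec g g) v = quadForm M v + (g ⬝ᵥ v) ^ 2 := by
  simp only [quadForm, Matrix.add_mulVec, dotProduct_add, Matrix.vecMulVec_mulVec,
    op_smul_eq_smul, dotProduct_smul, smul_eq_mul]
  rw [dotProduct_comm v g]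
  ring

/-- The projection onto a convex set in the norm of `M` does not increase the distance to the
points of that set. -/
lemma IsArgmin.quadForm_le {M : Matrix (Fin d) (Fin d) ℝ} (hM : M.PosDef)
    {K : Set (Fin d → ℝ)} (hK : Convex ℝ K) {z y u : Fin d → ℝ}
    (hy : IsArgmin (fun x => weightedNorm M (z - x)) K y) (hu : u ∈ K) :
    quadForm M (y - u) ≤ quadForm M (z - u) := by
  set a := z - y
  set c := u - y
  have hQ := quadForm_nonneg hM c
  have key : ∀ s : ℝ, 0 < s → s ≤ 1 → 2 * (a ⬝ᵥ (M *ᵥ c)) ≤ s * quadForm M c := by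
    intro s hs hs1
    have hmem : y + s • c ∈ K := hK.add_smul_sub_mem hy.1 hu ⟨hs.le, hs1⟩
    have h1 : weightedNorm M (z - y) ≤ weightedNorm M (z - (y + s • c)) := hy.2 hmem
    have e : z - (y + s • c) = a - s • c := by simp only [a]; abel
    rw [e] at h1
    have h2 : quadForm M a ≤ quadForm M (a - s • c) :=
      (Real.sqrt_le_sqrt_iff (quadForm_nonneg hM _)).1 h1
    rw [quadForm_sub_smul hM] at h2
    refine le_of_mul_le_mul_left (a := s) ?_ hs
    linarith
  have h0 : a ⬝ᵥ (M *ᵥ c) ≤ 0 := by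
    by_contra! hpos
    have hlt : 0 < min 1 (a ⬝ᵥ (M *ᵥ c) / (quadForm M c + 1)) := lt_min one_pos (by positivity)
    have h1 := key _ hlt (min_le_left _ _)
    have h2 : min 1 (a ⬝ᵥ (M *ᵥ c) / (quadForm M c + 1)) * quadForm M c ≤ a ⬝ᵥ (M *ᵥ c) :=
      calc _ ≤ a ⬝ᵥ (M *ᵥ c) / (quadForm M c + 1) * (quadForm M c + 1) := by
            gcongr
            · exact min_le_right _ _
            · linarith
        _ = _ := div_mul_cancel₀ _ (by positivity)
    linarith
  have e1 : z - u = a - (1 : ℝ) • c := by simp only [a, c, one_smul]; abel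
  have e2 : y - u = 0 - (1 : ℝ) • c := by simp only [c, one_smul]; abel
  rw [e1, e2, quadForm_sub_smul hM, quadForm_sub_smul hM]
  have := quadForm_nonneg hM a
  have e3 : quadForm M (0 : Fin d → ℝ) = 0 := by simp [quadForm]
  rw [e3, zero_dotProduct]
  linarith

/-- One projected Newton step, compared with a point `u` of the feasible set. -/
lemma IsArgmin.newton_le {M : Matrix (Fin d) (Fin d) ℝ} (hM : M.PosDef)
    {K : Set (Fin d → ℝ)} (hK : Convex ℝ K) {β : ℝ} (hβ : 0 < β) {g y y' u : Fin d → ℝ}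
    (hy : IsArgmin (fun x => weightedNorm M (y - (1 / β) • (M⁻¹ *ᵥ g) - x)) K y') (hu : u ∈ K) :
    g ⬝ᵥ (y - u) ≤ 1 / (2 * β) * (g ⬝ᵥ (M⁻¹ *ᵥ g)) +
      β / 2 * (quadForm M (y - u) - quadForm M (y' - u)) := by
  have h := hy.quadForm_le hM hK hu
  have hinv : M *ᵥ (M⁻¹ *ᵥ g) = g := by
    rw [Matrix.mulVec_mulVec, Matrix.mul_nonsing_inv _ hM.det_pos.ne'.isUnit, Matrix.one_mulVec]
  have e : y - (1 / β) • (M⁻¹ *ᵥ g) - u = (y - u) - (1 / β) • (M⁻¹ *ᵥ g) := by abel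
  rw [e, quadForm_sub_smul hM, hinv] at h
  have e2 : quadForm M (M⁻¹ *ᵥ g) = g ⬝ᵥ (M⁻¹ *ᵥ g) := by
    rw [quadForm, hinv, dotProduct_comm]
  rw [e2, dotProduct_comm (y - u) g] at h
  have h2 := mul_le_mul_of_nonneg_left h (by positivity : 0 ≤ β / 2)
  have e3 : β / 2 * (quadForm M (y - u) - 2 * (1 / β) * (g ⬝ᵥ (y - u)) +
      (1 / β) ^ 2 * (g ⬝ᵥ (M⁻¹ *ᵥ g))) = β / 2 * quadForm M (y - u) - g ⬝ᵥ (y - u) +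
      1 / (2 * β) * (g ⬝ᵥ (M⁻¹ *ᵥ g)) := by
    field_simp
  rw [e3] at h2
  linarith

lemma posDef_add_vecMulVec {M : Matrix (Fin d) (Fin d) ℝ} (hM : M.PosDef) (g : Fin d → ℝ) :
    (M + Matrix.vecMulVec g g).PosDef := by
  have := Matrix.posSemidef_vecMulVec_self_star g
  rw [star_trivial] at this
  exact hM.add_posSemidef this

/-- A rank one update increases the log-determinant by at least `gᵀ (M + g gᵀ)⁻¹ g`. -/
lemma dotProduct_inv_mulVec_le_log_det {M : Matrix (Fin d) (Fin d) ℝ} (hM : M.PosDef)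
    (g : Fin d → ℝ) :
    g ⬝ᵥ ((M + Matrix.vecMulVec g g)⁻¹ *ᵥ g) ≤
      Real.log (M + Matrix.vecMulVec g g).det - Real.log M.det := by
  set M' := M + Matrix.vecMulVec g g with hM'
  have hpd : M'.PosDef := posDef_add_vecMulVec hM g
  have hdet : M.det = M'.det * (1 - g ⬝ᵥ (M'⁻¹ *ᵥ g)) := by
    have h := Matrix.det_add_replicateCol_mul_replicateRow (ι := Unit) (A := M')
      hpd.det_pos.ne'.isUnit (-g) g
    have e : M' + Matrix.replicateCol Unit (-g) * Matrix.replicateRow Unit g = M := by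
      rw [← Matrix.vecMulVec_eq, Matrix.neg_vecMulVec, hM']; abel
    rw [e] at h
    rw [h, Matrix.det_unique (n := Unit)]
    congr 1
    simp only [Matrix.add_apply, Matrix.one_apply_eq]
    rw [Matrix.mul_assoc, Matrix.mul_apply]
    simp only [Matrix.replicateRow_apply, sub_eq_add_neg]
    congr 1
    rw [← dotProduct_neg, ← Matrix.mulVec_neg]
    rfl
  have hpos : 0 < 1 - g ⬝ᵥ (M'⁻¹ *ᵥ g) := by
    have h1 := hM.det_pos
    rw [hdet] at h1
    exact (mul_pos_iff_of_pos_left hpd.det_pos).1 h1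
  have h2 := Real.log_le_sub_one_of_pos hpos
  rw [hdet, Real.log_mul hpd.det_pos.ne' hpos.ne']
  linarith

/-- The arithmetic-geometric mean inequality for the eigenvalues of a positive definite matrix. -/
lemma log_det_le {M : Matrix (Fin d) (Fin d) ℝ} (hM : M.PosDef) {c : ℝ} (hc : 0 < c)
    (htr : M.trace ≤ d * c) : Real.log M.det ≤ d * Real.log c := by
  have hev := fun i => hM.eigenvalues_pos i
  have htr' : M.trace = ∑ i, hM.isHermitian.eigenvalues i := by
    simpa using hM.isHermitian.trace_eq_sum_eigenvalues
  have hdet' : M.det = ∏ i, hM.isHermitian.eigenvalues i := by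
    simpa using hM.isHermitian.det_eq_prod_eigenvalues
  rw [hdet', Real.log_prod (fun i _ => (hev i).ne')]
  have h1 : ∀ i, Real.log (hM.isHermitian.eigenvalues i) ≤
      Real.log c + (hM.isHermitian.eigenvalues i / c - 1) := by
    intro i
    have h := Real.log_le_sub_one_of_pos (div_pos (hev i) hc)
    rw [Real.log_div (hev i).ne' hc.ne'] at h
    linarith
  refine (Finset.sum_le_sum fun i _ => h1 i).trans ?_
  rw [Finset.sum_add_distrib, Finset.sum_sub_distrib, ← Finset.sum_div, ← htr']
  have h2 : M.trace / c ≤ d := (div_le_iff₀ hc).2 htr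
  simp
  linarith

end Quadratic

/-! ### One round of FLH-ONS -/

section Surrogate

variable {d : ℕ}

lemma sqrt_half_eq (e : ℝ) : √(e / 2) = √(2 * e) / 2 := by
  have : e / 2 = 2 * e / 2 ^ 2 := by ring
  rw [this, Real.sqrt_div' _ (by positivity), Real.sqrt_sq (by norm_num)]

lemma surrogateLoss_eq {e : ℝ} (he : 0 < e) (g w y : Fin d → ℝ) :
    surrogateLoss e g w y = 1 / (2 * e) + (g ⬝ᵥ (y - w)) + e / 2 * (g ⬝ᵥ (y - w)) ^ 2 := by
  have h2 : 0 < √(2 * e) := Real.sqrt_pos.2 (by positivity)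
  have h3 : √(2 * e) ^ 2 = 2 * e := Real.sq_sqrt (by positivity)
  rw [surrogateLoss, surrogateRoot, sqrt_half_eq]
  have : (√(2 * e) / 2 * (g ⬝ᵥ (y - w)) + 1 / √(2 * e)) ^ 2 =
      √(2 * e) ^ 2 / 4 * (g ⬝ᵥ (y - w)) ^ 2 + (g ⬝ᵥ (y - w)) + 1 / √(2 * e) ^ 2 := by
    field_simp
    ring
  rw [this, h3]
  ring

lemma surrogateGrad_eq {e : ℝ} (he : 0 < e) (g w y : Fin d → ℝ) :
    surrogateGrad e g w y = (1 + e * (g ⬝ᵥ (y - w))) • g := by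
  have h2 : 0 < √(2 * e) := Real.sqrt_pos.2 (by positivity)
  have h3 : √(2 * e) ^ 2 = 2 * e := Real.sq_sqrt (by positivity)
  rw [surrogateGrad, surrogateRoot, sqrt_half_eq]
  congr 1
  have : 2 * (√(2 * e) / 2 * (g ⬝ᵥ (y - w)) + 1 / √(2 * e)) * (√(2 * e) / 2) =
      1 + √(2 * e) ^ 2 / 2 * (g ⬝ᵥ (y - w)) := by
    field_simp
    ring
  rw [this, h3]
  ring

/-- The tangent at `z = 0` lies above `z ↦ exp (-η (z + e z² / 2))`. For `z > 0` this reaches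
twice as far as concavity does: up to `η (1 + e z / 2)² = e`. -/
lemma exp_neg_le_one_sub {η e z : ℝ} (hη : 0 < η) (he : η ≤ e)
    (hz : 0 ≤ z → η * (1 + e * z / 2) ^ 2 ≤ e) :
    Real.exp (-η * (z + e / 2 * z ^ 2)) ≤ 1 - η * z := by
  rcases le_or_gt 0 z with h | h
  · set y := η * (z + e / 2 * z ^ 2) with hy
    have he0 : 0 < e := hη.trans_le he
    have hy0 : 0 ≤ y := by positivity
    have h1 := Real.quadratic_le_exp_of_nonneg hy0
    have h2 : Real.exp (-y) ≤ 1 - y + y ^ 2 / 2 := by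
      rw [Real.exp_neg, inv_le_comm₀ (Real.exp_pos _) (by nlinarith [sq_nonneg (y - 1)])]
      refine le_trans ?_ h1
      rw [inv_le_iff_one_le_mul₀ (by nlinarith [sq_nonneg (y - 1)])]
      nlinarith [sq_nonneg (y ^ 2)]
    have h3 : η * z ^ 2 / 2 * (η * (1 + e * z / 2) ^ 2) ≤ η * z ^ 2 / 2 * e :=
      mul_le_mul_of_nonneg_left (hz h) (by positivity)
    have h4 : y ^ 2 / 2 = η * z ^ 2 / 2 * (η * (1 + e * z / 2) ^ 2) := by rw [hy]; ring
    rw [neg_mul]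
    refine h2.trans ?_
    rw [h4]
    linarith
  · set t := -(η * z) with ht
    have ht0 : 0 < t := by rw [ht]; nlinarith
    have h1 := Real.le_log_one_add_of_nonneg ht0.le
    have h2 : t - t ^ 2 / 2 ≤ 2 * t / (t + 2) := by
      rw [le_div_iff₀ (by positivity)]
      nlinarith [pow_pos ht0 3]
    have h3 : -η * (z + e / 2 * z ^ 2) ≤ t - t ^ 2 / 2 := by
      have : η * z ^ 2 * η ≤ η * z ^ 2 * e := mul_le_mul_of_nonneg_left he (by positivity)
      rw [ht]
      linarith
    calc _ ≤ Real.exp (Real.log (1 + t)) := Real.exp_le_exp.2 (h3.trans (h2.trans h1))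
      _ = 1 + t := Real.exp_log (by positivity)
      _ = _ := by rw [ht]; ring

end Surrogate

section Parameters

variable {P : Params} {d : ℕ}

lemma Params.Pos.expConcavity_pos (hP : P.Pos) : 0 < P.expConcavity := by
  have := hP.L
  unfold Params.expConcavity; positivity

lemma Params.Pos.gamma_sq (hP : P.Pos) :
    P.gamma d ^ 2 = 2 * P.L * (1 + P.G * P.alpha * P.R * √(d : ℝ) / (2 * P.L)) ^ 2 := by
  have hL := hP.L
  have h2 : 0 < √(2 * P.L) := Real.sqrt_pos.2 (by positivity)
  have h3 : √(2 * P.L) ^ 2 = 2 * P.L := Real.sq_sqrt (by positivity)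
  have h4 : √((d : ℝ) / (8 * P.L)) = √(d : ℝ) / (2 * √(2 * P.L)) := by
    have : (8 * P.L) = 2 ^ 2 * (2 * P.L) := by ring
    rw [Real.sqrt_div (by positivity), this, Real.sqrt_mul (by positivity),
      Real.sqrt_sq (by norm_num)]
  have h5 : P.gamma d = √(2 * P.L) *
      (1 + P.G * P.alpha * P.R * √(d : ℝ) / √(2 * P.L) ^ 2) := by
    rw [Params.gamma, h4]
    field_simp
    ring
  rw [h5, mul_pow, h3]

lemma Params.Pos.eta_pos (hP : P.Pos) : 0 < P.eta d := by
  have hL := hP.L; have hG := hP.G; have hR := hP.R; have ha := hP.alpha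
  rw [Params.eta, hP.gamma_sq]
  positivity

lemma Params.Pos.eta_mul_sq_le (hP : P.Pos) {z : ℝ} (hz : 0 ≤ z)
    (hz' : z ≤ 4 * P.G * P.alpha * P.R * √(d : ℝ)) :
    P.eta d * (1 + P.expConcavity * z / 2) ^ 2 ≤ P.expConcavity := by
  have hL := hP.L; have hG := hP.G; have hR := hP.R; have ha := hP.alpha
  have he := hP.expConcavity_pos
  set κ := 1 + P.G * P.alpha * P.R * √(d : ℝ) / (2 * P.L) with hκ
  have hκ0 : 0 < κ := by positivity
  have h1 : 1 + P.expConcavity * z / 2 ≤ κ := by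
    rw [hκ, Params.expConcavity]
    have : 1 / (4 * P.L) * z / 2 ≤ 1 / (4 * P.L) * (4 * P.G * P.alpha * P.R * √(d : ℝ)) / 2 := by
      gcongr
    have e : 1 / (4 * P.L) * (4 * P.G * P.alpha * P.R * √(d : ℝ)) / 2 =
        P.G * P.alpha * P.R * √(d : ℝ) / (2 * P.L) := by field_simp
    linarith
  have heta := hP.eta_pos (d := d)
  calc P.eta d * (1 + P.expConcavity * z / 2) ^ 2 ≤ P.eta d * κ ^ 2 := by gcongr
    _ = P.expConcavity := by
        rw [Params.eta, hP.gamma_sq, ← hκ, Params.expConcavity]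
        field_simp
        norm_num

lemma Params.Pos.eta_le (hP : P.Pos) : P.eta d ≤ P.expConcavity := by
  have hL := hP.L; have hG := hP.G; have hR := hP.R; have ha := hP.alpha
  simpa using hP.eta_mul_sq_le (d := d) le_rfl (by positivity)

lemma Params.Pos.beta_pos (hP : P.Pos) (hd : 0 < d) : 0 < P.beta d := by
  have hL := hP.L; have hG := hP.G; have hR := hP.R; have ha := hP.alpha
  have he := hP.expConcavity_pos
  have : (0 : ℝ) < d := by exact_mod_cast hd
  unfold Params.beta
  positivity

lemma Params.beta_le : P.beta d ≤ P.expConcavity / 2 := by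
  have := min_le_right (1 / (4 * (2 * P.G * P.alpha) * (2 * P.R * √(d : ℝ)))) P.expConcavity
  unfold Params.beta
  linarith

lemma Params.Pos.zeta_pos (hP : P.Pos) (hd : 0 < d) : 0 < P.zeta d := by
  have hL := hP.L; have hG := hP.G; have hR := hP.R; have ha := hP.alpha
  have : (0 : ℝ) < d := by exact_mod_cast hd
  unfold Params.zeta
  rw [hP.gamma_sq]
  positivity

end Parameters

section Step

variable {P : Params} {d : ℕ}

/-- The size bounds on a subgradient `g` at the prediction `w` that the analysis of FLH-ONS uses. -/
structure BoundedGrad (P : Params) (w g : Fin d → ℝ) : Prop where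
  l1Norm_le : l1Norm g ≤ 2 * P.G * P.alpha
  abs_le : ∀ y ∈ box d P.R, |g ⬝ᵥ (y - w)| ≤ P.L

/-- A bound on the squared Euclidean norm of the gradients of the surrogate losses. -/
noncomputable def Params.gradSq (P : Params) : ℝ := 25 / 4 * (P.G * P.alpha) ^ 2

/-- The invariants of the states of FLH-ONS. -/
structure State.Valid (P : Params) (s : State d) : Prop where
  round_pos : 1 ≤ s.round
  weight_pos : ∀ j ∈ Finset.Icc 1 s.round, 0 < s.weight j
  sum_weight : ∑ j ∈ Finset.Icc 1 s.round, s.weight j = 1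
  expert_mem : ∀ j ∈ Finset.Icc 1 s.round, s.expert j ∈ box d P.R
  mat_posDef : ∀ j ∈ Finset.Icc 1 s.round, (s.mat j).PosDef
  mat_trace : ∀ j ∈ Finset.Icc 1 s.round, (s.mat j).trace ≤ P.zeta d * d + s.round * P.gradSq
  weight_round : s.weight s.round = 1 / s.round
  mat_round : s.mat s.round = P.zeta d • (1 : Matrix (Fin d) (Fin d) ℝ)
  expert_round : s.expert s.round = 0

lemma posDef_smul_one {c : ℝ} (hc : 0 < c) : (c • (1 : Matrix (Fin d) (Fin d) ℝ)).PosDef :=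
  Matrix.PosDef.one.smul hc

lemma Params.gradSq_nonneg : 0 ≤ P.gradSq := by unfold Params.gradSq; positivity

lemma State.valid_init (hP : P.Pos) (hd : 0 < d) : (State.init P : State d).Valid P where
  round_pos := le_rfl
  weight_pos := by simp [State.init]
  sum_weight := by simp [State.init]
  expert_mem := fun _ _ => zero_mem_box hP.R.le
  mat_posDef := fun _ _ => posDef_smul_one (hP.zeta_pos hd)
  mat_trace := fun _ _ => by
    have := P.gradSq_nonneg
    simp [State.init, this]
  weight_round := by simp [State.init]
  mat_round := rfl
  expert_round := rfl

lemma State.Valid.predict_mem {s : State d} (hs : s.Valid P) : s.predict ∈ box d P.R :=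
  (convex_box d P.R).sum_mem (fun j hj => (hs.weight_pos j hj).le) hs.sum_weight hs.expert_mem

lemma State.Valid.dotProduct_predict {s : State d} (hs : s.Valid P) (g : Fin d → ℝ) :
    ∑ j ∈ Finset.Icc 1 s.round, s.weight j * (g ⬝ᵥ (s.expert j - s.predict)) = 0 := by
  simp only [dotProduct_sub, mul_sub, Finset.sum_sub_distrib, ← Finset.sum_mul, hs.sum_weight]
  rw [State.predict, dotProduct_sum]
  simp [dotProduct_smul]

lemma abs_dotProduct_sub_le {g : Fin d → ℝ} (hP : P.Pos) (hg : l1Norm g ≤ 2 * P.G * P.alpha)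
    {y w : Fin d → ℝ} (hy : y ∈ box d P.R) (hw : w ∈ box d P.R) :
    |g ⬝ᵥ (y - w)| ≤ 4 * P.G * P.alpha * P.R := by
  have h1 : ∀ i, |(y - w) i| ≤ 2 * P.R := fun i => by
    refine (abs_sub (y i) (w i)).trans ?_
    linarith [hy i, hw i]
  have := (abs_dotProduct_le g (y - w) h1).trans
    (mul_le_mul_of_nonneg_right hg (by linarith [hP.R]))
  linarith

/-- The mixed exponential losses of the experts are at most the exponential loss of the
prediction. -/
lemma State.Valid.sum_weight_exp_le {s : State d} (hs : s.Valid P) (hP : P.Pos) (hd : 0 < d)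
    {g : Fin d → ℝ} (hg : BoundedGrad P s.predict g) :
    ∑ j ∈ Finset.Icc 1 s.round, s.weight j * Real.exp
      (-(P.eta d) * surrogateLoss P.expConcavity g s.predict (s.expert j)) ≤
    Real.exp (-(P.eta d) * (1 / (2 * P.expConcavity))) := by
  have he := hP.expConcavity_pos
  have hd1 : 1 ≤ √(d : ℝ) := Real.one_le_sqrt.2 (by exact_mod_cast hd)
  have h1 : ∀ j ∈ Finset.Icc 1 s.round, s.weight j * Real.exp
      (-(P.eta d) * surrogateLoss P.expConcavity g s.predict (s.expert j)) ≤
      Real.exp (-(P.eta d) * (1 / (2 * P.expConcavity))) *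
        (s.weight j - P.eta d * (s.weight j * (g ⬝ᵥ (s.expert j - s.predict)))) := by
    intro j hj
    set z := g ⬝ᵥ (s.expert j - s.predict)
    have hz : |z| ≤ 4 * P.G * P.alpha * P.R * √(d : ℝ) := by
      refine (abs_dotProduct_sub_le hP hg.l1Norm_le (hs.expert_mem j hj) hs.predict_mem).trans ?_
      have := hP.G; have := hP.alpha; have := hP.R
      exact le_mul_of_one_le_right (by positivity) hd1
    have h2 := exp_neg_le_one_sub (z := z) (hP.eta_pos (d := d)) hP.eta_le
      (fun h => hP.eta_mul_sq_le h ((le_abs_self z).trans hz))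
    rw [surrogateLoss_eq he, add_assoc, mul_add, Real.exp_add]
    calc _ ≤ s.weight j * (Real.exp (-(P.eta d) * (1 / (2 * P.expConcavity))) *
          (1 - P.eta d * z)) := by
          have := hs.weight_pos j hj
          gcongr
      _ = _ := by ring
  refine (Finset.sum_le_sum h1).trans (le_of_eq ?_)
  rw [← Finset.mul_sum, Finset.sum_sub_distrib, ← Finset.mul_sum, hs.sum_weight,
    hs.dotProduct_predict]
  simp

/-- The regret of FLH against expert `j` in one round is paid by the growth of
`log (weight j) + log round`. -/
lemma FLHStep.surrogateLoss_le {s s' : State d} {g : Fin d → ℝ} (hP : P.Pos) (hd : 0 < d)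
    (hs : s.Valid P) (hg : BoundedGrad P s.predict g) (h : FLHStep P s g s') {j : ℕ}
    (hj : j ∈ Finset.Icc 1 s.round) :
    0 < s'.weight j ∧
    1 / (2 * P.expConcavity) - surrogateLoss P.expConcavity g s.predict (s.expert j) ≤
      1 / P.eta d * ((Real.log (s'.weight j) + Real.log s'.round) -
        (Real.log (s.weight j) + Real.log s.round)) := by
  have heta := hP.eta_pos (d := d)
  have hr : (0 : ℝ) < s.round := by exact_mod_cast hs.round_pos
  set W := ∑ j ∈ Finset.Icc 1 s.round, s.weight j * Real.exp
      (-(P.eta d) * surrogateLoss P.expConcavity g s.predict (s.expert j)) with hW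
  have hW0 : 0 < W := Finset.sum_pos
    (fun i hi => mul_pos (hs.weight_pos i hi) (Real.exp_pos _)) ⟨j, hj⟩
  have hWle := hs.sum_weight_exp_le hP hd hg
  have hlogW : Real.log W ≤ -(P.eta d) * (1 / (2 * P.expConcavity)) := by
    rw [← Real.log_exp (-(P.eta d) * (1 / (2 * P.expConcavity)))]
    exact Real.log_le_log hW0 hWle
  have hwj := hs.weight_pos j hj
  have e1 : (1 - 1 / ((s.round : ℝ) + 1)) = s.round / (s.round + 1) := by field_simp; ring
  have hw' := h.weight_old j hj
  rw [← hW, e1] at hw'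
  have hpos : 0 < s'.weight j := by
    rw [hw']
    have := Real.exp_pos (-(P.eta d) * surrogateLoss P.expConcavity g s.predict (s.expert j))
    positivity
  refine ⟨hpos, ?_⟩
  have hlog : Real.log (s'.weight j) = Real.log s.round - Real.log (s.round + 1) +
      (Real.log (s.weight j) +
        -(P.eta d) * surrogateLoss P.expConcavity g s.predict (s.expert j) - Real.log W) := by
    have hE := Real.exp_pos (-(P.eta d) * surrogateLoss P.expConcavity g s.predict (s.expert j))
    rw [hw', Real.log_mul (by positivity) (by positivity), Real.log_div (by positivity)
      (by positivity), Real.log_div (by positivity) (by positivity),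
      Real.log_mul (by positivity) (by positivity), Real.log_exp]
  rw [hlog, h.round_eq, one_div_mul_eq_div, le_div_iff₀ heta]
  push_cast
  linarith

/-- The regret of an ONS expert in one round, up to the terms that telescope. -/
lemma FLHStep.expert_le {s s' : State d} {g : Fin d → ℝ} (hP : P.Pos) (hd : 0 < d)
    (hs : s.Valid P) (hg : BoundedGrad P s.predict g) (h : FLHStep P s g s') {j : ℕ}
    (hj : j ∈ Finset.Icc 1 s.round) {u : Fin d → ℝ} (hu : u ∈ box d P.R) :
    surrogateLoss P.expConcavity g s.predict (s.expert j) -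
        surrogateLoss P.expConcavity g s.predict u ≤
      1 / (2 * P.beta d) * (Real.log (s'.mat j).det - Real.log (s.mat j).det) +
      P.beta d / 2 * (quadForm (s.mat j) (s.expert j - u) -
        quadForm (s'.mat j) (s'.expert j - u)) := by
  have he := hP.expConcavity_pos
  have hβ := hP.beta_pos hd
  set e := P.expConcavity
  set w := s.predict
  set y := s.expert j
  set z := g ⬝ᵥ (y - w) with hz
  set v := surrogateGrad e g w y
  have hmat : s'.mat j = s.mat j + Matrix.vecMulVec v v := h.mat_old j hj
  have hpd : (s'.mat j).PosDef := hmat ▸ posDef_add_vecMulVec (hs.mat_posDef j hj) v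
  have h1 := (h.expert_old j hj).newton_le hpd (convex_box d P.R) hβ hu
  have h2 := dotProduct_inv_mulVec_le_log_det (hs.mat_posDef j hj) v
  rw [← hmat] at h2
  have h3 : quadForm (s'.mat j) (y - u) = quadForm (s.mat j) (y - u) + (v ⬝ᵥ (y - u)) ^ 2 := by
    rw [hmat, quadForm_add_vecMulVec]
  have hv : v = (1 + e * z) • g := surrogateGrad_eq he g w y
  set t := g ⬝ᵥ (y - u) with ht
  have hvt : v ⬝ᵥ (y - u) = (1 + e * z) * t := by rw [hv, smul_dotProduct, smul_eq_mul]
  have hu' : g ⬝ᵥ (u - w) = z - t := by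
    rw [hz, ht, ← dotProduct_sub]; congr 1; abel
  have h4 : surrogateLoss e g w y - surrogateLoss e g w u = (1 + e * z) * t - e / 2 * t ^ 2 := by
    rw [surrogateLoss_eq he, surrogateLoss_eq he, hu', ← hz]
    ring
  have hez : |e * z| ≤ 1 / 4 := by
    rw [abs_mul, abs_of_pos he]
    calc e * |z| ≤ e * P.L := by gcongr; exact hg.abs_le y (hs.expert_mem j hj)
      _ = 1 / 4 := by
        have := hP.L
        simp only [e, Params.expConcavity]
        field_simp
  have h5 : P.beta d / 2 * ((1 + e * z) * t) ^ 2 ≤ e / 2 * t ^ 2 := by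
    have h6 : (1 + e * z) ^ 2 ≤ 2 := by
      rw [_root_.abs_le] at hez
      nlinarith [hez.1, hez.2]
    have h7 : P.beta d ≤ e / 2 := P.beta_le
    calc _ = P.beta d / 2 * (1 + e * z) ^ 2 * t ^ 2 := by ring
      _ ≤ (e / 2) / 2 * 2 * t ^ 2 := by gcongr
      _ = _ := by ring
  have h8 := mul_le_mul_of_nonneg_left h2 (by positivity : 0 ≤ 1 / (2 * P.beta d))
  change v ⬝ᵥ (y - u) ≤ 1 / (2 * P.beta d) * (v ⬝ᵥ ((s'.mat j)⁻¹ *ᵥ v)) +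
      P.beta d / 2 * (quadForm (s'.mat j) (y - u) - quadForm (s'.mat j) (s'.expert j - u)) at h1
  rw [h3, hvt] at h1
  rw [h4]
  linarith

/-- The potential of expert `j` for the comparator `u`: in every round it decreases by at least
the surrogate regret of the prediction against `u`. -/
noncomputable def potential (P : Params) (s : State d) (j : ℕ) (u : Fin d → ℝ) : ℝ :=
  P.beta d / 2 * quadForm (s.mat j) (s.expert j - u) -
    1 / (2 * P.beta d) * Real.log (s.mat j).det -
    1 / P.eta d * (Real.log (s.weight j) + Real.log s.round)

lemma FLHStep.surrogateRegret_le {s s' : State d} {g : Fin d → ℝ} (hP : P.Pos) (hd : 0 < d)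
    (hs : s.Valid P) (hg : BoundedGrad P s.predict g) (h : FLHStep P s g s') {j : ℕ}
    (hj : j ∈ Finset.Icc 1 s.round) {u : Fin d → ℝ} (hu : u ∈ box d P.R) :
    surrogateRegret P.expConcavity g s.predict u ≤ potential P s j u - potential P s' j u := by
  have h1 := (h.surrogateLoss_le hP hd hs hg hj).2
  have h2 := h.expert_le hP hd hs hg hj hu
  have e : g ⬝ᵥ (s.predict - u) = -(g ⬝ᵥ (u - s.predict)) := by
    rw [← dotProduct_neg, neg_sub]
  have h3 : surrogateRegret P.expConcavity g s.predict u =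
      1 / (2 * P.expConcavity) - surrogateLoss P.expConcavity g s.predict u := by
    rw [surrogateLoss_eq hP.expConcavity_pos, surrogateRegret, e]
    ring
  rw [h3]
  unfold potential
  linarith

lemma sum_sq_le_l1Norm_sq (g : Fin d → ℝ) : g ⬝ᵥ g ≤ l1Norm g ^ 2 := by
  have h := (le_abs_self _).trans (abs_dotProduct_le g g (abs_le_l1Norm g))
  rwa [← sq] at h

lemma FLHStep.valid {s s' : State d} {g : Fin d → ℝ} (hP : P.Pos) (hd : 0 < d)
    (hs : s.Valid P) (hg : BoundedGrad P s.predict g) (h : FLHStep P s g s') : s'.Valid P := by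
  have hr : (0 : ℝ) < s.round := by exact_mod_cast hs.round_pos
  have hB := P.gradSq_nonneg
  have hIcc : Finset.Icc 1 s'.round = insert (s.round + 1) (Finset.Icc 1 s.round) := by
    rw [h.round_eq]; ext i; simp; omega
  have hnot : s.round + 1 ∉ Finset.Icc 1 s.round := by simp
  have hcast : (s'.round : ℝ) = s.round + 1 := by rw [h.round_eq]; push_cast; rfl
  refine ⟨by rw [h.round_eq]; omega, ?_, ?_, ?_, ?_, ?_, ?_, ?_, ?_⟩
  · rw [hIcc, Finset.forall_mem_insert, h.weight_new]
    exact ⟨by positivity, fun j hj => (h.surrogateLoss_le hP hd hs hg hj).1⟩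
  · rw [hIcc, Finset.sum_insert hnot, h.weight_new, Finset.sum_congr rfl h.weight_old,
      ← Finset.mul_sum, ← Finset.sum_div, div_self]
    · ring
    · exact (Finset.sum_pos (fun i hi => mul_pos (hs.weight_pos i hi) (Real.exp_pos _))
        ⟨1, Finset.mem_Icc.2 ⟨le_rfl, hs.round_pos⟩⟩).ne'
  · rw [hIcc, Finset.forall_mem_insert, h.expert_new]
    exact ⟨zero_mem_box hP.R.le, fun j hj => (h.expert_old j hj).1⟩
  · rw [hIcc, Finset.forall_mem_insert, h.mat_new]
    exact ⟨posDef_smul_one (hP.zeta_pos hd), fun j hj => by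
      rw [h.mat_old j hj]; exact posDef_add_vecMulVec (hs.mat_posDef j hj) _⟩
  · rw [hIcc, Finset.forall_mem_insert, h.mat_new, hcast]
    refine ⟨?_, fun j hj => ?_⟩
    · simp only [Matrix.trace_smul, Matrix.trace_one, Fintype.card_fin, smul_eq_mul]
      have : 0 ≤ ((s.round : ℝ) + 1) * P.gradSq := by positivity
      linarith
    · rw [h.mat_old j hj, Matrix.trace_add, Matrix.trace_vecMulVec,
        surrogateGrad_eq hP.expConcavity_pos]
      have h1 := hs.mat_trace j hj
      set z := g ⬝ᵥ (s.expert j - s.predict) with hz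
      have hez : |P.expConcavity * z| ≤ 1 / 4 := by
        rw [abs_mul, abs_of_pos hP.expConcavity_pos]
        calc _ ≤ P.expConcavity * P.L :=
              mul_le_mul_of_nonneg_left (hg.abs_le _ (hs.expert_mem j hj))
                hP.expConcavity_pos.le
          _ = 1 / 4 := by
            have := hP.L
            simp only [Params.expConcavity]
            field_simp
      have h6 : (1 + P.expConcavity * z) ^ 2 ≤ 25 / 16 := by
        rw [_root_.abs_le] at hez
        nlinarith [hez.1, hez.2]
      have h7 : l1Norm g ^ 2 ≤ (2 * P.G * P.alpha) ^ 2 :=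
        pow_le_pow_left₀ (l1Norm_nonneg g) hg.l1Norm_le 2
      have h8 : (1 + P.expConcavity * z) ^ 2 * (g ⬝ᵥ g) ≤ 25 / 16 * (2 * P.G * P.alpha) ^ 2 :=
        mul_le_mul h6 ((sum_sq_le_l1Norm_sq g).trans h7)
          (Finset.sum_nonneg fun i _ => mul_self_nonneg _) (by norm_num)
      simp only [smul_dotProduct, dotProduct_smul, smul_eq_mul]
      have h9 : P.gradSq = 25 / 16 * (2 * P.G * P.alpha) ^ 2 := by unfold Params.gradSq; ring
      rw [add_mul, one_mul, h9]
      rw [h9] at h1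
      linarith
  · rw [hcast, h.round_eq, h.weight_new]
  · rw [h.round_eq, h.mat_new]
  · rw [h.round_eq, h.expert_new]

end Step
/-! ### Bounds on the potential -/

section Potential

variable {P : Params} {d : ℕ}

lemma State.Valid.potential_round_le {s : State d} (hs : s.Valid P) (hP : P.Pos) (hd : 0 < d)
    {u : Fin d → ℝ} (hu : u ∈ box d P.R) :
    potential P s s.round u ≤
      P.beta d / 2 * (P.zeta d * (d * P.R ^ 2)) - 1 / (2 * P.beta d) * (d * Real.log (P.zeta d)) := by
  have hr : (0 : ℝ) < s.round := by exact_mod_cast hs.round_pos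
  have hζ := hP.zeta_pos hd
  have hβ := hP.beta_pos hd
  have h1 : quadForm (P.zeta d • (1 : Matrix (Fin d) (Fin d) ℝ)) (0 - u) ≤
      P.zeta d * (d * P.R ^ 2) := by
    simp only [quadForm, Matrix.smul_mulVec, Matrix.one_mulVec, dotProduct_smul, smul_eq_mul,
      zero_sub, dotProduct_neg, neg_dotProduct, neg_neg]
    refine mul_le_mul_of_nonneg_left ?_ hζ.le
    calc u ⬝ᵥ u ≤ ∑ _i : Fin d, P.R ^ 2 := Finset.sum_le_sum fun i _ => by
          rw [← sq, ← sq_abs]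
          exact pow_le_pow_left₀ (abs_nonneg _) (hu i) 2
      _ = _ := by simp
  have h2 : (P.zeta d • (1 : Matrix (Fin d) (Fin d) ℝ)).det = P.zeta d ^ d := by
    simp
  rw [potential, hs.mat_round, hs.expert_round, hs.weight_round, h2, Real.log_pow, one_div (s.round : ℝ),
    Real.log_inv]
  have h3 := mul_le_mul_of_nonneg_left h1 (by positivity : 0 ≤ P.beta d / 2)
  simp only [neg_add_cancel, mul_zero, sub_zero]
  linarith

lemma State.Valid.le_potential {s : State d} (hs : s.Valid P) (hP : P.Pos) (hd : 0 < d)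
    (u : Fin d → ℝ) {j : ℕ} (hj : j ∈ Finset.Icc 1 s.round) :
    -(1 / (2 * P.beta d) * (d * Real.log (P.zeta d + s.round * P.gradSq / d))) -
      1 / P.eta d * Real.log s.round ≤ potential P s j u := by
  have hζ := hP.zeta_pos hd
  have hβ := hP.beta_pos hd
  have heta := hP.eta_pos (d := d)
  have hB := P.gradSq_nonneg
  have hd' : (0 : ℝ) < d := by exact_mod_cast hd
  have hc : 0 < P.zeta d + s.round * P.gradSq / d := by positivity
  have h1 := log_det_le (hs.mat_posDef j hj) hc
    ((hs.mat_trace j hj).trans (le_of_eq (by field_simp)))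
  have h2 : Real.log (s.weight j) ≤ 0 := by
    refine Real.log_nonpos (hs.weight_pos j hj).le ?_
    rw [← hs.sum_weight]
    exact Finset.single_le_sum (f := s.weight) (fun i hi => (hs.weight_pos i hi).le) hj
  have h3 := mul_nonneg (by positivity : 0 ≤ P.beta d / 2)
    (quadForm_nonneg (hs.mat_posDef j hj) (s.expert j - u))
  have h4 := mul_le_mul_of_nonneg_left h1 (by positivity : 0 ≤ 1 / (2 * P.beta d))
  have h5 := mul_nonpos_of_nonneg_of_nonpos (by positivity : 0 ≤ 1 / P.eta d) h2
  unfold potential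
  rw [mul_add]
  linarith

/-- The constant of `γ² ≤ gammaConst · d`. -/
noncomputable def Params.gammaConst (P : Params) : ℝ :=
  2 * P.L * (1 + P.G * P.alpha * P.R / (2 * P.L)) ^ 2

/-- The constant of the interval regret bound of FLH-ONS. -/
noncomputable def Params.intervalConst (P : Params) : ℝ :=
  1 / (1024 * (P.G * P.alpha) ^ 2) / Real.log 2 +
    (16 * P.G * P.alpha * P.R + 4 * P.L) *
      (1 + Real.log (1 + P.gradSq * (16 * P.G * P.alpha * P.R + 4 * P.gammaConst)) / Real.log 2) +
    2 * P.gammaConst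

lemma Params.Pos.gamma_sq_le (hP : P.Pos) (hd : 0 < d) : P.gamma d ^ 2 ≤ P.gammaConst * d := by
  have hL := hP.L; have hG := hP.G; have hR := hP.R; have ha := hP.alpha
  have hd1 : 1 ≤ √(d : ℝ) := Real.one_le_sqrt.2 (by exact_mod_cast hd)
  rw [hP.gamma_sq, Params.gammaConst]
  calc _ ≤ 2 * P.L * ((1 + P.G * P.alpha * P.R / (2 * P.L)) * √(d : ℝ)) ^ 2 := by
        gcongr
        rw [add_mul, one_mul, mul_div_right_comm]
        linarith
    _ = _ := by rw [mul_pow, Real.sq_sqrt (by positivity)]; ring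

lemma inv_min_le {a b : ℝ} (ha : 0 < a) (hb : 0 < b) : 1 / min a b ≤ 1 / a + 1 / b := by
  have h1 : 0 < 1 / a := by positivity
  have h2 : 0 < 1 / b := by positivity
  rcases min_choice a b with h | h <;> rw [h] <;> linarith

lemma Params.Pos.inv_two_mul_beta_le (hP : P.Pos) (hd : 0 < d) :
    1 / (2 * P.beta d) ≤ (16 * P.G * P.alpha * P.R + 4 * P.L) * √(d : ℝ) := by
  have hL := hP.L; have hG := hP.G; have hR := hP.R; have ha := hP.alpha
  have he := hP.expConcavity_pos
  have hd1 : 1 ≤ √(d : ℝ) := Real.one_le_sqrt.2 (by exact_mod_cast hd)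
  have hd0 : 0 < √(d : ℝ) := by linarith
  have e : 2 * P.beta d =
      min (1 / (4 * (2 * P.G * P.alpha) * (2 * P.R * √(d : ℝ)))) P.expConcavity := by
    unfold Params.beta; ring
  rw [e]
  refine (inv_min_le (by positivity) he).trans ?_
  rw [Params.expConcavity, one_div_one_div, one_div_one_div]
  nlinarith

lemma Params.Pos.inv_zeta_le (hP : P.Pos) (hd : 0 < d) :
    1 / P.zeta d ≤ (16 * P.G * P.alpha * P.R + 4 * P.gammaConst) * d := by
  have hL := hP.L; have hG := hP.G; have hR := hP.R; have ha := hP.alpha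
  have hd1 : 1 ≤ √(d : ℝ) := Real.one_le_sqrt.2 (by exact_mod_cast hd)
  have hd0 : 0 < √(d : ℝ) := by linarith
  have hγ : 0 < P.gamma d ^ 2 := by rw [hP.gamma_sq]; positivity
  unfold Params.zeta
  refine (inv_min_le (by positivity) (by positivity)).trans ?_
  rw [one_div_one_div, one_div_one_div]
  have h1 := hP.gamma_sq_le hd
  have h2 : √(d : ℝ) ≤ d := by
    nlinarith [Real.sq_sqrt (by positivity : (0 : ℝ) ≤ d)]
  have h3 : 16 * P.G * P.alpha * P.R * √(d : ℝ) ≤ 16 * P.G * P.alpha * P.R * d := by gcongr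
  linarith

lemma Params.Pos.beta_mul_zeta_le (hP : P.Pos) (hd : 0 < d) :
    P.beta d / 2 * (P.zeta d * (d * P.R ^ 2)) ≤ 1 / (1024 * (P.G * P.alpha) ^ 2) := by
  have hL := hP.L; have hG := hP.G; have hR := hP.R; have ha := hP.alpha
  have hd' : (0 : ℝ) < d := by exact_mod_cast hd
  have hd0 : 0 < √(d : ℝ) := Real.sqrt_pos.2 hd'
  have h1 : P.zeta d ≤ 1 / (16 * P.G * P.alpha * P.R * √(d : ℝ)) := min_le_left _ _
  have h2 : P.beta d ≤ 1 / 2 * (1 / (4 * (2 * P.G * P.alpha) * (2 * P.R * √(d : ℝ)))) :=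
    mul_le_mul_of_nonneg_left (min_le_left _ _) (by norm_num)
  have hζ := hP.zeta_pos hd
  calc P.beta d / 2 * (P.zeta d * (d * P.R ^ 2))
      ≤ 1 / 2 * (1 / (4 * (2 * P.G * P.alpha) * (2 * P.R * √(d : ℝ)))) / 2 *
        (1 / (16 * P.G * P.alpha * P.R * √(d : ℝ)) * (√(d : ℝ) ^ 2 * P.R ^ 2)) := by
        rw [Real.sq_sqrt hd'.le]
        gcongr
    _ = _ := by field_simp; norm_num

/-- The `log d` of the determinant bound is absorbed since `1 / (ζ d)` is bounded. -/
lemma Params.Pos.intervalConst_bound (hP : P.Pos) (hd : 0 < d) {n k : ℕ} (hn : 2 ≤ n)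
    (hk : 1 ≤ k) (hkn : k ≤ n) :
    P.beta d / 2 * (P.zeta d * (d * P.R ^ 2)) +
      1 / (2 * P.beta d) * (d * (Real.log (P.zeta d + k * P.gradSq / d) - Real.log (P.zeta d))) +
      1 / P.eta d * Real.log k ≤ P.intervalConst * (d * √(d : ℝ)) * Real.log n := by
  have hL := hP.L; have hG := hP.G; have hR := hP.R; have ha := hP.alpha
  have hd' : (0 : ℝ) < d := by exact_mod_cast hd
  have hd1' : (1 : ℝ) ≤ d := by exact_mod_cast hd
  have hd1 : 1 ≤ √(d : ℝ) := Real.one_le_sqrt.2 hd1'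
  have hζ := hP.zeta_pos hd
  have hβ := hP.beta_pos hd
  have hB := P.gradSq_nonneg
  have hk' : (1 : ℝ) ≤ k := by exact_mod_cast hk
  have hkn' : (k : ℝ) ≤ n := by exact_mod_cast hkn
  have hn' : (2 : ℝ) ≤ n := by exact_mod_cast hn
  have hlog2 : 0 < Real.log 2 := Real.log_pos (by norm_num)
  have hlogn : Real.log 2 ≤ Real.log n := Real.log_le_log (by norm_num) hn'
  have hΓ : 0 ≤ P.gammaConst := by unfold Params.gammaConst; positivity
  have hdd : (1 : ℝ) ≤ d * √(d : ℝ) := one_le_mul_of_one_le_of_one_le hd1' hd1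
  set E := P.gradSq * (16 * P.G * P.alpha * P.R + 4 * P.gammaConst) with hE
  have hE0 : 0 ≤ E := by positivity
  have hlogE : 0 ≤ Real.log (1 + E) := Real.log_nonneg (by linarith)
  have t1 : P.beta d / 2 * (P.zeta d * (d * P.R ^ 2)) ≤
      1 / (1024 * (P.G * P.alpha) ^ 2) / Real.log 2 * (d * √(d : ℝ)) * Real.log n := by
    refine (hP.beta_mul_zeta_le hd).trans ?_
    set X := 1 / (1024 * (P.G * P.alpha) ^ 2)
    have hX : 0 ≤ X := by positivity
    calc X = X / Real.log 2 * 1 * Real.log 2 := by field_simp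
      _ ≤ _ := by gcongr
  have t2 : Real.log (P.zeta d + k * P.gradSq / d) - Real.log (P.zeta d) ≤
      (1 + Real.log (1 + E) / Real.log 2) * Real.log n := by
    rw [← Real.log_div (by positivity) (by positivity)]
    have h1 : (P.zeta d + k * P.gradSq / d) / P.zeta d ≤ n * (1 + E) := by
      have h2 : k * P.gradSq / d / P.zeta d ≤ n * E := by
        calc k * P.gradSq / d / P.zeta d = k * P.gradSq / d * (1 / P.zeta d) := by ring
          _ ≤ n * P.gradSq / d * ((16 * P.G * P.alpha * P.R + 4 * P.gammaConst) * d) := by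
            gcongr
            exact hP.inv_zeta_le hd
          _ = n * E := by rw [hE]; field_simp
      rw [add_div, div_self hζ.ne']
      linarith
    calc _ ≤ Real.log (n * (1 + E)) := Real.log_le_log (by positivity) h1
      _ = Real.log n + Real.log (1 + E) / Real.log 2 * Real.log 2 := by
        rw [Real.log_mul (by positivity) (by positivity), div_mul_cancel₀ _ hlog2.ne']
      _ ≤ Real.log n + Real.log (1 + E) / Real.log 2 * Real.log n := by gcongr
      _ = _ := by ring
  have t2' : 1 / (2 * P.beta d) *
      (d * (Real.log (P.zeta d + k * P.gradSq / d) - Real.log (P.zeta d))) ≤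
      (16 * P.G * P.alpha * P.R + 4 * P.L) * (1 + Real.log (1 + E) / Real.log 2) *
        (d * √(d : ℝ)) * Real.log n := by
    have hlogn0 : 0 ≤ Real.log n := by linarith
    calc _ ≤ ((16 * P.G * P.alpha * P.R + 4 * P.L) * √(d : ℝ)) *
          (d * ((1 + Real.log (1 + E) / Real.log 2) * Real.log n)) := by
          refine mul_le_mul (hP.inv_two_mul_beta_le hd) (by gcongr) ?_ (by positivity)
          refine mul_nonneg hd'.le (sub_nonneg.2 (Real.log_le_log hζ ?_))
          have : 0 ≤ k * P.gradSq / d := by positivity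
          linarith
      _ = _ := by ring
  have t3 : 1 / P.eta d * Real.log k ≤ 2 * P.gammaConst * (d * √(d : ℝ)) * Real.log n := by
    have e : 1 / P.eta d = 2 * P.gamma d ^ 2 := by rw [Params.eta, one_div_one_div]
    rw [e]
    have hlogk : 0 ≤ Real.log k := Real.log_nonneg hk'
    have : Real.log k ≤ Real.log n := Real.log_le_log (by linarith) hkn'
    calc _ ≤ 2 * (P.gammaConst * d) * Real.log n := by
          gcongr
          exact hP.gamma_sq_le hd
      _ = 2 * P.gammaConst * (d * 1) * Real.log n := by ring
      _ ≤ _ := by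
        have : 0 ≤ Real.log n := by linarith
        gcongr
  rw [Params.intervalConst, ← hE]
  linarith

lemma State.Valid.potential_sub_le {s s' : State d} (hs : s.Valid P) (hs' : s'.Valid P)
    (hP : P.Pos) (hd : 0 < d) {n : ℕ} (hn : 2 ≤ n) (hsn : s'.round ≤ n)
    {u : Fin d → ℝ} (hu : u ∈ box d P.R) {j : ℕ} (hj : j ∈ Finset.Icc 1 s'.round) :
    potential P s s.round u - potential P s' j u ≤
      P.intervalConst * (d * √(d : ℝ)) * Real.log n := by
  have h1 := hs.potential_round_le hP hd hu
  have h2 := hs'.le_potential hP hd u hj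
  have h3 := hP.intervalConst_bound hd hn hs'.round_pos hsn
  linarith

end Potential

/-! ### Interleaved copies of FLH-ONS -/

section Interleaved

variable {P : Params} {d n τ : ℕ}

/-- `σ t` is the state from which the interleaved copies of FLH-ONS predict at time `t`. The
subgradient `g t` of time `t` becomes available for the prediction at time `t + τ`; the ones that
come too late to be used before time `n` are set to zero. -/
structure Interleaved (P : Params) (τ n : ℕ) (σ : ℕ → State d) (g : ℕ → Fin d → ℝ) : Prop where
  init : ∀ t, 1 ≤ t → t ≤ τ → t ≤ n → σ t = State.init P
  step : ∀ t, 1 ≤ t → t + τ ≤ n → FLHStep P (σ t) (g t) (σ (t + τ))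
  bounded : ∀ t, 1 ≤ t → t + τ ≤ n → (σ t).predict ∈ box d P.R →
    BoundedGrad P (σ t).predict (g t)
  late : ∀ t, n < t + τ → g t = 0

variable {σ : ℕ → State d} {g : ℕ → Fin d → ℝ}

lemma Interleaved.valid (h : Interleaved P τ n σ g) (hP : P.Pos) (hd : 0 < d) (hτ : 1 ≤ τ)
    {t : ℕ} (ht : 1 ≤ t) (htn : t ≤ n) : (σ t).Valid P ∧ (σ t).round ≤ t := by
  induction t using Nat.strong_induction_on with
  | _ t ih =>
    by_cases hle : t ≤ τ
    · rw [h.init t ht hle htn]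
      exact ⟨State.valid_init hP hd, ht⟩
    · obtain ⟨t', rfl⟩ : ∃ t', t = t' + τ := ⟨t - τ, by omega⟩
      have h1 := ih t' (by omega) (by omega) (by omega)
      have hs := h.step t' (by omega) htn
      refine ⟨hs.valid hP hd h1.1 (h.bounded t' (by omega) htn h1.1.predict_mem), ?_⟩
      rw [hs.round_eq]
      omega

lemma sum_range_sub_shift (F : ℕ → ℝ) (m τ : ℕ) :
    ∑ i ∈ Finset.range m, (F i - F (i + τ)) =
      ∑ i ∈ Finset.range τ, (F i - F (m + i)) := by
  have h1 := Finset.sum_range_add F m τ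
  have h2 := Finset.sum_range_add F τ m
  rw [add_comm τ m] at h2
  simp only [Finset.sum_sub_distrib]
  simp only [add_comm _ τ]
  linarith

lemma Interleaved.sum_range_le (h : Interleaved P τ n σ g) (hP : P.Pos) (hd : 0 < d)
    (hτ : 1 ≤ τ) (hn : 2 ≤ n) {r m : ℕ} (hr : 1 ≤ r) (hm : 1 ≤ m) (hrm : r + m + τ ≤ n + 1)
    {u : Fin d → ℝ} (hu : u ∈ box d P.R) :
    ∑ i ∈ Finset.range m, surrogateRegret P.expConcavity (g (r + i)) (σ (r + i)).predict u ≤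
      τ * (P.intervalConst * (d * √(d : ℝ)) * Real.log n) := by
  -- The expert followed at time `r + i` is the one started at the first prediction, at or after
  -- time `r`, of the instance that is active at time `r + i`.
  set J : ℕ → ℕ := fun i => (σ (r + i % τ)).round with hJdef
  have hJ : ∀ i, r + i ≤ n → J i ∈ Finset.Icc 1 (σ (r + i)).round := by
    intro i
    induction i using Nat.strong_induction_on with
    | _ i ih =>
      intro hi
      by_cases hlt : i < τ
      · have hv := (h.valid hP hd hτ (t := r + i) (by omega) hi).1.round_pos
        simp only [hJdef, Nat.mod_eq_of_lt hlt]
        exact Finset.mem_Icc.2 ⟨hv, le_rfl⟩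
      · obtain ⟨i', rfl⟩ : ∃ i', i = i' + τ := ⟨i - τ, by omega⟩
        have h1 := ih i' (by omega) (by omega)
        have hs := h.step (r + i') (by omega) (by omega)
        simp only [hJdef, Nat.add_mod_right, ← add_assoc, hs.round_eq, Finset.mem_Icc] at h1 ⊢
        omega
  set F : ℕ → ℝ := fun i => potential P (σ (r + i)) (J i) u with hF
  have h1 : ∀ i ∈ Finset.range m,
      surrogateRegret P.expConcavity (g (r + i)) (σ (r + i)).predict u ≤ F i - F (i + τ) := by
    intro i hi
    rw [Finset.mem_range] at hi
    have hv := (h.valid hP hd hτ (t := r + i) (by omega) (by omega)).1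
    have h2 := (h.step (r + i) (by omega) (by omega)).surrogateRegret_le hP hd hv
      (h.bounded (r + i) (by omega) (by omega) hv.predict_mem) (hJ i (by omega)) hu
    have e : J (i + τ) = J i := by simp [hJdef]
    simp only [hF, e, ← add_assoc]
    exact h2
  refine (Finset.sum_le_sum h1).trans ?_
  rw [sum_range_sub_shift]
  calc _ ≤ ∑ _i ∈ Finset.range τ, P.intervalConst * (d * √(d : ℝ)) * Real.log n := by
        refine Finset.sum_le_sum fun i hi => ?_
        rw [Finset.mem_range] at hi
        have hv := h.valid hP hd hτ (t := r + i) (by omega) (by omega)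
        have hv' := h.valid hP hd hτ (t := r + (m + i)) (by omega) (by omega)
        have e : J i = (σ (r + i)).round := by simp [hJdef, Nat.mod_eq_of_lt hi]
        simp only [hF]
        rw [e]
        exact hv.1.potential_sub_le hv'.1 hP hd hn (by omega) hu (hJ (m + i) (by omega))
    _ = _ := by simp

lemma Params.Pos.intervalConst_pos (hP : P.Pos) : 0 < P.intervalConst := by
  have hL := hP.L; have hG := hP.G; have hR := hP.R; have ha := hP.alpha
  have hB := P.gradSq_nonneg
  have hlog2 : 0 < Real.log 2 := Real.log_pos (by norm_num)
  have hΓ : 0 ≤ P.gammaConst := by unfold Params.gammaConst; positivity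
  have hlogE : 0 ≤ Real.log (1 + P.gradSq * (16 * P.G * P.alpha * P.R + 4 * P.gammaConst)) :=
    Real.log_nonneg (by
      have : 0 ≤ P.gradSq * (16 * P.G * P.alpha * P.R + 4 * P.gammaConst) := by positivity
      linarith)
  unfold Params.intervalConst
  positivity

/-- On every interval the surrogate regret against a fixed point of the box is logarithmic. -/
lemma Interleaved.sum_Ico_le (h : Interleaved P τ n σ g) (hP : P.Pos) (hd : 0 < d)
    (hτ : 1 ≤ τ) (hn : 2 ≤ n) {r s : ℕ} (hr : 1 ≤ r)
    {u : Fin d → ℝ} (hu : u ∈ box d P.R) :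
    ∑ t ∈ Finset.Ico r s, surrogateRegret P.expConcavity (g t) (σ t).predict u ≤
      τ * (P.intervalConst * (d * √(d : ℝ)) * Real.log n) := by
  set s' := min s (n + 1 - τ) with hs'
  have e : ∑ t ∈ Finset.Ico r s, surrogateRegret P.expConcavity (g t) (σ t).predict u =
      ∑ t ∈ Finset.Ico r s', surrogateRegret P.expConcavity (g t) (σ t).predict u := by
    symm
    refine Finset.sum_subset (Finset.Ico_subset_Ico le_rfl (min_le_left _ _)) fun t ht ht' => ?_
    rw [h.late t (by simp only [Finset.mem_Ico, hs'] at ht ht'; omega)]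
    simp [surrogateRegret]
  rw [e, Finset.sum_Ico_eq_sum_range]
  rcases Nat.eq_zero_or_pos (s' - r) with h0 | h0
  · rw [h0, Finset.sum_range_zero]
    have := hP.intervalConst_pos
    have : 0 ≤ Real.log n := Real.log_natCast_nonneg n
    positivity
  · exact h.sum_range_le hP hd hτ hn hr h0 (by omega) hu

end Interleaved

/-! ### The delayed algorithm -/

section Delayed

variable {p d n τ : ℕ} {D : Set (Fin d → ℝ)} {P : Params}
  {A : ℕ → Matrix (Fin p) (Fin d) ℝ} {b : ℕ → Fin p → ℝ} {S : ℕ → ℕ → State d}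
  {x : ℕ → Fin d → ℝ}

lemma DelayedRun.state_eq (h : DelayedRun D P τ n A b S x) {i : ℕ} (hi : i < τ) {a t : ℕ}
    (hat : a ≤ t) (htn : t ≤ n) (hne : ∀ t', a < t' → t' ≤ t → i ≠ (t' - 1) % τ) :
    S t i = S a i := by
  induction t, hat using Nat.le_induction with
  | base => rfl
  | succ t hat ih =>
    rw [h.idle (t + 1) (by simp; omega) i hi (hne (t + 1) (by omega) le_rfl), Nat.add_sub_cancel]
    exact ih (by omega) fun t' h1 h2 => hne t' h1 (by omega)

lemma DelayedRun.state_init (h : DelayedRun D P τ n A b S x) {t : ℕ} (ht : 1 ≤ t)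
    (htτ : t ≤ τ) (htn : t ≤ n) : S t ((t - 1) % τ) = State.init P := by
  rw [h.first t (by simp; omega) htτ]
  have hi : (t - 1) % τ < τ := Nat.mod_lt _ (by omega)
  rw [h.state_eq hi (a := 0) (Nat.zero_le _) (by omega), h.init _ hi]
  intro t' h1 h2
  rw [Nat.mod_eq_of_lt (by omega), Nat.mod_eq_of_lt (by omega)]
  omega

lemma DelayedRun.state_update (h : DelayedRun D P τ n A b S x) (hτ : 1 ≤ τ) {t : ℕ} (ht : 1 ≤ t)
    (htn : t + τ ≤ n) :
    Update D P (A t) (b t) (S t ((t - 1) % τ)) (S (t + τ) ((t + τ - 1) % τ)) := by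
  have h1 := h.update (t + τ) (by simp; omega) (by omega)
  have e : (t + τ - 1) % τ = (t - 1) % τ := by
    rw [show t + τ - 1 = t - 1 + τ by omega, Nat.add_mod_right]
  rw [Nat.add_sub_cancel, e] at h1
  rw [h.state_eq (a := t) (Nat.mod_lt _ (by omega)) (by omega) (by omega)] at h1
  · rwa [e]
  · intro t' h2 h3 heq
    have h4 : t - 1 ≡ t' - 1 [MOD τ] := heq
    rw [Nat.modEq_iff_dvd' (by omega)] at h4
    have := Nat.le_of_dvd (by omega) h4
    omega

/-- The delayed run is an interleaved run of FLH-ONS, and its regret is bounded by the surrogate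
regret up to the last `τ` rounds. -/
lemma DelayedRun.exists_interleaved (h : DelayedRun D P τ n A b S x) (hP : P.Pos) (hd : 0 < d)
    (hτ : 1 ≤ τ) (hconv : Convex ℝ D) (hDbox : D ⊆ box d P.R)
    (hdata : ∀ t ∈ Finset.Icc 1 n, DataBounds P (A t) (b t)) :
    ∃ g : ℕ → Fin d → ℝ, Interleaved P τ n (fun t => S t ((t - 1) % τ)) g ∧
      ∀ t ∈ Finset.Icc 1 n, ∀ u ∈ D,
        regressionLoss (A t) (b t) (x t) - regressionLoss (A t) (b t) u ≤
          surrogateRegret P.expConcavity (g t) (S t ((t - 1) % τ)).predict u +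
            if t + τ ≤ n then 0 else P.L / 2 := by
  classical
  have hex : ∀ t, ∃ g : Fin d → ℝ, (1 ≤ t → t + τ ≤ n →
      IsSubgradient (penalizedLoss D P.G (A t) (b t)) (S t ((t - 1) % τ)).predict g ∧
        FLHStep P (S t ((t - 1) % τ)) g (S (t + τ) ((t + τ - 1) % τ))) ∧
      (n < t + τ → g = 0) := by
    intro t
    by_cases ht : 1 ≤ t ∧ t + τ ≤ n
    · obtain ⟨g, hg⟩ := h.state_update hτ ht.1 ht.2
      exact ⟨g, fun _ _ => hg, fun h' => by omega⟩
    · exact ⟨0, fun h1 h2 => absurd ⟨h1, h2⟩ ht, fun _ => rfl⟩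
  choose g hg hg0 using hex
  have hmem : ∀ t ∈ Finset.Icc 1 n, x t ∈ D := fun t ht => (h.play t ht).1
  have hI : Interleaved P τ n (fun t => S t ((t - 1) % τ)) g :=
    { init := fun t h1 h2 h3 => h.state_init h1 h2 h3
      step := fun t h1 h2 => (hg t h1 h2).2
      bounded := fun t h1 h2 hw => by
        have hD : D.Nonempty := ⟨x t, hmem t (by simp; omega)⟩
        have hdt := hdata t (by simp; omega)
        exact ⟨hdt.l1Norm_subgradient_le hP hD hconv hw (hg t h1 h2).1,
          fun y hy => hdt.abs_subgradient_dotProduct_le hP hD hconv hw (hg t h1 h2).1 hy⟩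
      late := fun t ht => hg0 t ht }
  refine ⟨g, hI, fun t ht u hu => ?_⟩
  obtain ⟨h1, h2⟩ := Finset.mem_Icc.1 ht
  have hdt := hdata t ht
  split_ifs with hlate
  · rw [add_zero]
    exact hdt.regret_le_surrogateRegret hP hconv hDbox
      (hI.valid hP hd hτ h1 h2).1.predict_mem (hg t h1 hlate).1 (h.play t ht) hu
  · rw [hg0 t (by omega)]
    have h3 := hdt.loss_bound (x t) (hDbox (hmem t ht))
    have h4 := regressionLoss_nonneg (A t) (b t) u
    simp only [surrogateRegret, zero_dotProduct]
    nlinarith [sq_nonneg P.G]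

end Delayed
/-! ### Averages over a uniform shift -/

section Mean

/-- `f` is integrable on `[0, 1]` and its mean there is `m`. -/
def HasMean (f : ℝ → ℝ) (m : ℝ) : Prop :=
  IntervalIntegrable f MeasureTheory.volume 0 1 ∧ ∫ U in (0 : ℝ)..1, f U = m

lemma HasMean.const (c : ℝ) : HasMean (fun _ => c) c :=
  ⟨intervalIntegrable_const, by simp⟩

lemma HasMean.add {f g : ℝ → ℝ} {a c : ℝ} (hf : HasMean f a) (hg : HasMean g c) :
    HasMean (fun U => f U + g U) (a + c) :=
  ⟨hf.1.add hg.1, by rw [intervalIntegral.integral_add hf.1 hg.1, hf.2, hg.2]⟩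

lemma HasMean.sub {f g : ℝ → ℝ} {a c : ℝ} (hf : HasMean f a) (hg : HasMean g c) :
    HasMean (fun U => f U - g U) (a - c) :=
  ⟨hf.1.sub hg.1, by rw [intervalIntegral.integral_sub hf.1 hg.1, hf.2, hg.2]⟩

lemma HasMean.const_mul {f : ℝ → ℝ} {a : ℝ} (c : ℝ) (hf : HasMean f a) :
    HasMean (fun U => c * f U) (c * a) :=
  ⟨hf.1.const_mul c, by rw [intervalIntegral.integral_const_mul, hf.2]⟩

lemma HasMean.sum {ι : Type*} {s : Finset ι} {f : ι → ℝ → ℝ} {a : ι → ℝ}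
    (h : ∀ i ∈ s, HasMean (f i) (a i)) : HasMean (fun U => ∑ i ∈ s, f i U) (∑ i ∈ s, a i) := by
  classical
  induction s using Finset.induction_on with
  | empty => simpa using HasMean.const 0
  | insert i s hi ih =>
    simp only [Finset.sum_insert hi]
    exact (h i (Finset.mem_insert_self i s)).add
      (ih fun j hj => h j (Finset.mem_insert_of_mem hj))

lemma HasMean.le_of_forall_le {f : ℝ → ℝ} {m K : ℝ} (hf : HasMean f m)
    (h : ∀ U, 0 < U → U < 1 → K ≤ f U) : K ≤ m := by
  rw [← hf.2, ← (HasMean.const K).2]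
  exact intervalIntegral.integral_mono_on_of_le_Ioo zero_le_one (HasMean.const K).1 hf.1
    fun U hU => h U hU.1 hU.2

/-- Rounding after a uniform shift is unbiased. -/
lemma hasMean_floor (y : ℝ) : HasMean (fun U => (⌊y + U⌋ : ℝ)) y := by
  have hmono : Monotone fun U : ℝ => (⌊y + U⌋ : ℝ) := fun a c hac =>
    Int.cast_le.2 (Int.floor_le_floor (by linarith))
  refine ⟨hmono.intervalIntegrable, ?_⟩
  set φ := Int.fract y
  have h0 : 0 ≤ φ := Int.fract_nonneg y
  have h1 : φ < 1 := Int.fract_lt_one y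
  have hy : (⌊y⌋ : ℝ) + φ = y := Int.floor_add_fract y
  rw [← intervalIntegral.integral_add_adjacent_intervals (b := 1 - φ) hmono.intervalIntegrable
    hmono.intervalIntegrable,
    intervalIntegral.integral_congr_Ioo_of_le (g := fun _ => (⌊y⌋ : ℝ)) (by linarith),
    intervalIntegral.integral_congr_Ioo_of_le (a := 1 - φ) (g := fun _ => (⌊y⌋ : ℝ) + 1)
      (by linarith)]
  · simp only [intervalIntegral.integral_const, smul_eq_mul]
    linarith
  · intro U hU
    have : ⌊y + U⌋ = ⌊y⌋ + 1 := by
      rw [Int.floor_eq_iff]; push_cast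
      constructor <;> linarith [hU.1, hU.2]
    simp [this]
  · intro U hU
    have : ⌊y + U⌋ = ⌊y⌋ := by
      rw [Int.floor_eq_iff]
      constructor <;> linarith [hU.1, hU.2]
    simp [this]

lemma hasMean_abs_floor_sub (y z : ℝ) :
    HasMean (fun U => |(⌊y + U⌋ : ℝ) - ⌊z + U⌋|) |y - z| := by
  wlog h : z ≤ y generalizing y z
  · simpa only [abs_sub_comm] using this z y (by linarith)
  · have e : (fun U => |(⌊y + U⌋ : ℝ) - ⌊z + U⌋|) = fun U => (⌊y + U⌋ : ℝ) - ⌊z + U⌋ := by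
      funext U
      refine abs_of_nonneg (sub_nonneg.2 (Int.cast_le.2 (Int.floor_le_floor ?_)))
      linarith
    rw [e, abs_of_nonneg (sub_nonneg.2 h)]
    exact (hasMean_floor y).sub (hasMean_floor z)

end Mean

/-! ### Dithered comparators -/

section Dither

variable {d : ℕ}

/-- The coordinates of `u` rounded to the grid of mesh `R / N`, after a common shift by the
fraction `U` of the mesh. -/
noncomputable def dither (R : ℝ) (N : ℕ) (U : ℝ) (u : Fin d → ℝ) : Fin d → ℝ :=
  fun i => R / N * ⌊N / R * u i + U⌋

/-- The mesh divides `R`, so that rounding does not leave the box. -/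
lemma dither_mem_box {R : ℝ} (hR : 0 < R) {N : ℕ} (hN : 1 ≤ N) {U : ℝ} (h0 : 0 < U) (h1 : U < 1)
    {u : Fin d → ℝ} (hu : u ∈ box d R) : dither R N U u ∈ box d R := by
  intro i
  have hN' : (0 : ℝ) < N := by exact_mod_cast hN
  have h := _root_.abs_le.1 (hu i)
  have e : (N : ℝ) / R * R = N := div_mul_cancel₀ _ hR.ne'
  have hNR : 0 < (N : ℝ) / R := by positivity
  have h2 : (N : ℝ) / R * u i ≤ N := by nlinarith [h.2]
  have h3 : -(N : ℝ) ≤ N / R * u i := by nlinarith [h.1]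
  have h4 : ⌊(N : ℝ) / R * u i + U⌋ ≤ (N : ℤ) := by
    rw [← Int.lt_add_one_iff, Int.floor_lt]; push_cast; linarith
  have h5 : -(N : ℤ) ≤ ⌊(N : ℝ) / R * u i + U⌋ := by
    rw [Int.le_floor]; push_cast; linarith
  have h6 : |((⌊(N : ℝ) / R * u i + U⌋ : ℤ) : ℝ)| ≤ N := by
    rw [_root_.abs_le]
    constructor
    · exact_mod_cast h5
    · exact_mod_cast h4
  rw [dither, abs_mul, abs_of_pos (by positivity : 0 < R / N)]
  calc R / N * |((⌊(N : ℝ) / R * u i + U⌋ : ℤ) : ℝ)| ≤ R / N * N := by gcongr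
    _ = R := div_mul_cancel₀ _ hN'.ne'

lemma sub_dither_apply {R : ℝ} (hR : 0 < R) {N : ℕ} (hN : 1 ≤ N) (U : ℝ) (u : Fin d → ℝ)
    (i : Fin d) : (u - dither R N U u) i = R / N * (N / R * u i - ⌊N / R * u i + U⌋) := by
  have hN' : (0 : ℝ) < N := by exact_mod_cast hN
  simp only [Pi.sub_apply, dither]
  field_simp

lemma abs_sub_dither_le {R : ℝ} (hR : 0 < R) {N : ℕ} (hN : 1 ≤ N) {U : ℝ} (h0 : 0 < U)
    (h1 : U < 1) (u : Fin d → ℝ) (i : Fin d) : |(u - dither R N U u) i| ≤ R / N := by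
  have hN' : (0 : ℝ) < N := by exact_mod_cast hN
  rw [sub_dither_apply hR hN, abs_mul, abs_of_pos (by positivity : 0 < R / N)]
  refine mul_le_of_le_one_right (by positivity) ?_
  have h2 := Int.floor_le ((N : ℝ) / R * u i + U)
  have h3 := Int.lt_floor_add_one ((N : ℝ) / R * u i + U)
  rw [_root_.abs_le]
  constructor <;> linarith

lemma hasMean_dotProduct_sub_dither {R : ℝ} (hR : 0 < R) {N : ℕ} (hN : 1 ≤ N)
    (g u : Fin d → ℝ) : HasMean (fun U => g ⬝ᵥ (u - dither R N U u)) 0 := by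
  have h : ∀ i ∈ (Finset.univ : Finset (Fin d)),
      HasMean (fun U => g i * (u - dither R N U u) i) 0 := by
    intro i _
    have h1 := (((HasMean.const ((N : ℝ) / R * u i)).sub
      (hasMean_floor ((N : ℝ) / R * u i))).const_mul (R / N)).const_mul (g i)
    simp only [sub_dither_apply hR hN]
    simpa using h1
  simpa [dotProduct] using HasMean.sum h

/-- A piecewise constant comparator sequence costs one interval bound for each of its pieces. -/
lemma sum_le_mul_switches {X : Type*} {K : Set X} {q : ℕ → X → ℝ} {B : ℝ}
    (hq : ∀ r s, 1 ≤ r → ∀ v ∈ K, ∑ t ∈ Finset.Ico r s, q t v ≤ B) {n : ℕ} (hn : 1 ≤ n)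
    {v : ℕ → X} (hv : ∀ t ∈ Finset.Icc 1 n, v t ∈ K) [DecidableEq X] :
    ∑ t ∈ Finset.Icc 1 n, q t (v t) ≤
      B * (1 + ∑ t ∈ Finset.Icc 2 n, if v t = v (t - 1) then 0 else 1) := by
  have key : ∀ m, 1 ≤ m → m ≤ n → ∃ r, 1 ≤ r ∧ r ≤ m ∧ (∀ t ∈ Finset.Ico r (m + 1), v t = v m) ∧
      ∑ t ∈ Finset.Ico 1 r, q t (v t) ≤
        B * ∑ t ∈ Finset.Icc 2 m, if v t = v (t - 1) then 0 else 1 := by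
    intro m hm
    induction m, hm using Nat.le_induction with
    | base =>
      refine fun _ => ⟨1, le_rfl, le_rfl, fun t ht => ?_, by simp⟩
      simp only [Finset.mem_Ico] at ht
      rw [show t = 1 by omega]
    | succ m hm ih =>
      intro hmn
      obtain ⟨r, h1, h2, h3, h4⟩ := ih (by omega)
      rw [Finset.sum_Icc_succ_top (by omega), Nat.add_sub_cancel]
      by_cases heq : v (m + 1) = v m
      · refine ⟨r, h1, by omega, fun t ht => ?_, by simpa [heq] using h4⟩
        simp only [Finset.mem_Ico] at ht
        rcases Nat.lt_or_ge t (m + 1) with h | h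
        · rw [heq]; exact h3 t (Finset.mem_Ico.2 ⟨ht.1, h⟩)
        · rw [show t = m + 1 by omega]
      · refine ⟨m + 1, by omega, le_rfl, fun t ht => ?_, ?_⟩
        · simp only [Finset.mem_Ico] at ht
          rw [show t = m + 1 by omega]
        · rw [← Finset.sum_Ico_consecutive _ h1 (by omega : r ≤ m + 1), if_neg heq, mul_add, mul_one]
          refine add_le_add h4 ?_
          rw [Finset.sum_congr rfl fun t ht => by rw [h3 t ht]]
          exact hq r (m + 1) h1 (v m) (hv m (Finset.mem_Icc.2 ⟨hm, by omega⟩))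
  obtain ⟨r, h1, h2, h3, h4⟩ := key n hn le_rfl
  have e : Finset.Icc 1 n = Finset.Ico 1 (n + 1) := by ext; simp
  rw [e, ← Finset.sum_Ico_consecutive _ h1 (by omega : r ≤ n + 1), mul_add, mul_one, add_comm]
  refine add_le_add ?_ h4
  rw [Finset.sum_congr rfl fun t ht => by rw [h3 t ht]]
  exact hq r (n + 1) h1 (v n) (hv n (Finset.mem_Icc.2 ⟨hn, le_rfl⟩))

lemma dither_switch_le (R : ℝ) (N : ℕ) (U : ℝ) (u u' : Fin d → ℝ)
    [Decidable (dither R N U u = dither R N U u')] :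
    (if dither R N U u = dither R N U u' then (0 : ℝ) else 1) ≤
      ∑ i, |(⌊(N : ℝ) / R * u i + U⌋ : ℝ) - ⌊(N : ℝ) / R * u' i + U⌋| := by
  split_ifs with h
  · exact Finset.sum_nonneg fun _ _ => abs_nonneg _
  · obtain ⟨i, hi⟩ : ∃ i, ⌊(N : ℝ) / R * u i + U⌋ ≠ ⌊(N : ℝ) / R * u' i + U⌋ := by
      by_contra! hall
      exact h (funext fun i => by simp only [dither, hall i])
    have h1 : (1 : ℝ) ≤ |(⌊(N : ℝ) / R * u i + U⌋ : ℝ) - ⌊(N : ℝ) / R * u' i + U⌋| := by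
      exact_mod_cast Int.one_le_abs (sub_ne_zero.2 hi)
    exact h1.trans (Finset.single_le_sum
      (f := fun i => |(⌊(N : ℝ) / R * u i + U⌋ : ℝ) - ⌊(N : ℝ) / R * u' i + U⌋|)
      (fun _ _ => abs_nonneg _) (Finset.mem_univ i))

lemma surrogateRegret_sub (e : ℝ) (g w u v : Fin d → ℝ) :
    surrogateRegret e g w u = surrogateRegret e g w v +
      ((e * (g ⬝ᵥ (w - u)) - 1) * (g ⬝ᵥ (u - v)) + e / 2 * (g ⬝ᵥ (u - v)) ^ 2) := by
  have h : g ⬝ᵥ (w - v) = g ⬝ᵥ (w - u) + g ⬝ᵥ (u - v) := by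
    rw [← dotProduct_add, sub_add_sub_cancel]
  rw [surrogateRegret, surrogateRegret, h]
  ring

/-- The surrogate regret against a moving comparator. The dithered comparator is unbiased, so the
first order terms of the quadratic surrogates cancel on average, and the expected number of its
switches is the path variation divided by the mesh `R / N`. -/
lemma Interleaved.sum_le_totalVariation {P : Params} {n τ : ℕ} {σ : ℕ → State d}
    {g : ℕ → Fin d → ℝ} (h : Interleaved P τ n σ g) (hP : P.Pos) (hd : 0 < d)
    (hτ : 1 ≤ τ) (hn : 2 ≤ n) {u : ℕ → Fin d → ℝ} (hu : ∀ t ∈ Finset.Icc 1 n, u t ∈ box d P.R)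
    {N : ℕ} (hN : 1 ≤ N) :
    ∑ t ∈ Finset.Icc 1 n, surrogateRegret P.expConcavity (g t) (σ t).predict (u t) ≤
      τ * (P.intervalConst * (d * √(d : ℝ)) * Real.log n) *
        (1 + N / P.R * totalVariation n u) +
      n * (P.expConcavity / 2 * (2 * P.G * P.alpha * (P.R / N)) ^ 2) := by
  classical
  have hR := hP.R
  have he := hP.expConcavity_pos
  set e := P.expConcavity
  set B := τ * (P.intervalConst * (d * √(d : ℝ)) * Real.log n) with hB
  have hB0 : 0 ≤ B := by
    have := hP.intervalConst_pos
    have : 0 ≤ Real.log n := Real.log_natCast_nonneg n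
    positivity
  set c := e / 2 * (2 * P.G * P.alpha * (P.R / N)) ^ 2 with hc
  have hg1 : ∀ t ∈ Finset.Icc 1 n, l1Norm (g t) ≤ 2 * P.G * P.alpha := by
    intro t ht
    obtain ⟨h1, h2⟩ := Finset.mem_Icc.1 ht
    by_cases hlate : t + τ ≤ n
    · exact (h.bounded t h1 hlate (h.valid hP hd hτ h1 h2).1.predict_mem).l1Norm_le
    · rw [h.late t (by omega)]
      have := hP.G; have := hP.alpha
      simp only [l1Norm, Pi.zero_apply, abs_zero, Finset.sum_const_zero]
      positivity
  have hmean1 : HasMean (fun U => ∑ t ∈ Finset.Icc 2 n, ∑ i,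
      |(⌊(N : ℝ) / P.R * u t i + U⌋ : ℝ) - ⌊(N : ℝ) / P.R * u (t - 1) i + U⌋|)
      (N / P.R * totalVariation n u) := by
    have h1 := HasMean.sum (s := Finset.Icc 2 n) fun t _ =>
      HasMean.sum (s := (Finset.univ : Finset (Fin d))) fun i _ =>
        hasMean_abs_floor_sub ((N : ℝ) / P.R * u t i) (N / P.R * u (t - 1) i)
    convert h1 using 1
    simp only [totalVariation, l1Norm, Finset.mul_sum, Pi.sub_apply]
    refine Finset.sum_congr rfl fun t _ => Finset.sum_congr rfl fun i _ => ?_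
    rw [← mul_sub, abs_mul, abs_of_nonneg (by positivity : 0 ≤ (N : ℝ) / P.R)]
  have hmean2 : HasMean (fun U => ∑ t ∈ Finset.Icc 1 n,
      (e * (g t ⬝ᵥ ((σ t).predict - u t)) - 1) *
        (g t ⬝ᵥ (u t - dither P.R N U (u t)))) 0 := by
    have h1 := HasMean.sum (s := Finset.Icc 1 n) fun t _ =>
      (hasMean_dotProduct_sub_dither hR hN (g t) (u t)).const_mul
        (e * (g t ⬝ᵥ ((σ t).predict - u t)) - 1)
    simpa using h1
  have hmean := ((((HasMean.const 1).add hmean1).const_mul B).add hmean2).add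
    (HasMean.const (n * c))
  rw [add_zero] at hmean
  refine hmean.le_of_forall_le fun U hU0 hU1 => ?_
  have hsw := sum_le_mul_switches (K := box d P.R) (B := B)
    (q := fun t v => surrogateRegret e (g t) (σ t).predict v)
    (fun r s hr v hv => h.sum_Ico_le hP hd hτ hn hr hv) (n := n) (by omega)
    (v := fun t => dither P.R N U (u t)) (fun t ht => dither_mem_box hR hN hU0 hU1 (hu t ht))
  have hsw2 : B * (1 + ∑ t ∈ Finset.Icc 2 n,
      if dither P.R N U (u t) = dither P.R N U (u (t - 1)) then (0 : ℝ) else 1) ≤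
      B * (1 + ∑ t ∈ Finset.Icc 2 n, ∑ i,
        |(⌊(N : ℝ) / P.R * u t i + U⌋ : ℝ) - ⌊(N : ℝ) / P.R * u (t - 1) i + U⌋|) := by
    gcongr
    exact dither_switch_le _ _ _ _ _
  have hq : ∑ t ∈ Finset.Icc 1 n, surrogateRegret e (g t) (σ t).predict (u t) ≤
      ∑ t ∈ Finset.Icc 1 n, (surrogateRegret e (g t) (σ t).predict (dither P.R N U (u t)) +
        (e * (g t ⬝ᵥ ((σ t).predict - u t)) - 1) *
          (g t ⬝ᵥ (u t - dither P.R N U (u t))) + c) := by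
    refine Finset.sum_le_sum fun t ht => ?_
    rw [surrogateRegret_sub e (g t) _ (u t) (dither P.R N U (u t)), add_assoc]
    gcongr
    rw [← sq_abs]
    have h1 := abs_dotProduct_le (g t) _ (abs_sub_dither_le hR hN hU0 hU1 (u t))
    have h2 : |g t ⬝ᵥ (u t - dither P.R N U (u t))| ≤ 2 * P.G * P.alpha * (P.R / N) :=
      h1.trans (mul_le_mul_of_nonneg_right (hg1 t ht) (by positivity))
    rw [hc]
    gcongr
  rw [Finset.sum_add_distrib, Finset.sum_add_distrib, Finset.sum_const, Nat.card_Icc,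
    Nat.add_sub_cancel, nsmul_eq_mul] at hq
  linarith

end Dither
/-! ### Tuning the mesh and the regret bounds -/

section Final

variable {p d n τ : ℕ} {D : Set (Fin d → ℝ)} {P : Params}
  {A : ℕ → Matrix (Fin p) (Fin d) ℝ} {b : ℕ → Fin p → ℝ} {S : ℕ → ℕ → State d}
  {x : ℕ → Fin d → ℝ}

lemma sum_late_le {c : ℝ} (hc : 0 ≤ c) (τ n : ℕ) {s : Finset ℕ} (hs : s ⊆ Finset.Icc 1 n) :
    ∑ t ∈ s, (if t + τ ≤ n then 0 else c) ≤ τ * c := by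
  have h1 : ∀ t, (if t + τ ≤ n then 0 else c) = if ¬ t + τ ≤ n then c else 0 := fun t => by
    split_ifs <;> rfl
  simp only [h1]
  rw [← Finset.sum_filter, Finset.sum_const, nsmul_eq_mul]
  refine mul_le_mul_of_nonneg_right ?_ hc
  have h2 : s.filter (fun t => ¬ t + τ ≤ n) ⊆ Finset.Ioc (n - τ) n := by
    intro t ht
    rw [Finset.mem_filter] at ht
    have := Finset.mem_Icc.1 (hs ht.1)
    rw [Finset.mem_Ioc]
    omega
  have h3 := Finset.card_le_card h2
  rw [Nat.card_Ioc] at h3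
  exact_mod_cast h3.trans (by omega)

lemma totalVariation_nonneg (n : ℕ) (u : ℕ → Fin d → ℝ) : 0 ≤ totalVariation n u :=
  Finset.sum_nonneg fun _ _ => l1Norm_nonneg _

/-- The value of `κ n / N² + B τ T N / R`, minimized over the number `N` of grid points, has the
order of `τ^{2/3} n^{1/3} T^{2/3}` when the optimal mesh `(τ T / n)^{1/3}` is at most `R`. -/
lemma exists_mesh {T R κ B : ℝ} {n τ : ℕ} (hn : 1 ≤ n) (hτ : 1 ≤ τ) (hR : 0 < R)
    (hκ : 0 ≤ κ) (hB : 0 ≤ B) (hT : 0 ≤ T) (hTn : τ * T ≤ n * R ^ 3) :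
    ∃ N : ℕ, 1 ≤ N ∧ τ * B * (N / R * T) + n * (κ / N ^ 2) ≤
      (2 * B + κ + κ / R ^ 2) *
        max ((τ : ℝ) ^ (2 / 3 : ℝ) * (n : ℝ) ^ (1 / 3 : ℝ) * T ^ (2 / 3 : ℝ)) τ := by
  have hn' : (1 : ℝ) ≤ n := by exact_mod_cast hn
  have hτ' : (1 : ℝ) ≤ τ := by exact_mod_cast hτ
  set X := (τ : ℝ) ^ (2 / 3 : ℝ) * (n : ℝ) ^ (1 / 3 : ℝ) * T ^ (2 / 3 : ℝ) with hX
  rcases hT.eq_or_lt with h0 | h0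
  · refine ⟨n, hn, ?_⟩
    rw [← h0]
    have h1 : n * (κ / (n : ℝ) ^ 2) ≤ κ := by
      have : n * (κ / (n : ℝ) ^ 2) = κ / n := by field_simp
      rw [this]
      exact div_le_self hκ hn'
    have h2 : 1 ≤ max X τ := hτ'.trans (le_max_right _ _)
    have h3 : 0 ≤ κ / R ^ 2 := by positivity
    calc _ = n * (κ / (n : ℝ) ^ 2) := by ring
      _ ≤ (2 * B + κ + κ / R ^ 2) * 1 := by linarith
      _ ≤ _ := by gcongr
  · set y := (τ * T / n : ℝ) ^ (1 / 3 : ℝ) with hy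
    have hbase : 0 < τ * T / (n : ℝ) := by positivity
    have hy0 : 0 < y := Real.rpow_pos_of_pos hbase _
    have hy3 : y ^ 3 = τ * T / n := by
      rw [hy, ← Real.rpow_natCast, ← Real.rpow_mul hbase.le]
      norm_num
    have hyR : y ≤ R := by
      refine le_of_pow_le_pow_left₀ (n := 3) (by norm_num) hR.le ?_
      rw [hy3, div_le_iff₀ (by linarith)]
      linarith
    have hXy : X = n * y ^ 2 := by
      have h1 : y ^ 2 = (τ * T / n : ℝ) ^ (2 / 3 : ℝ) := by
        rw [hy, ← Real.rpow_natCast, ← Real.rpow_mul hbase.le]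
        norm_num
      have h2 : (n : ℝ) = (n : ℝ) ^ (1 / 3 : ℝ) * (n : ℝ) ^ (2 / 3 : ℝ) := by
        rw [← Real.rpow_add (by linarith)]
        norm_num
      rw [h1, Real.div_rpow (by positivity) (by positivity), Real.mul_rpow (by positivity) hT, hX]
      have h3 : 0 < (n : ℝ) ^ (2 / 3 : ℝ) := Real.rpow_pos_of_pos (by linarith) _
      rw [mul_div_assoc', eq_div_iff h3.ne']
      nth_rewrite 3 [h2]
      ring
    have hX0 : 0 ≤ X := by rw [hXy]; positivity
    have hRy : 1 ≤ R / y := (one_le_div hy0).2 hyR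
    have hN1 : R / y ≤ ⌈R / y⌉₊ := Nat.le_ceil _
    have hN2 : (⌈R / y⌉₊ : ℝ) ≤ 2 * (R / y) := by
      have := Nat.ceil_lt_add_one (by positivity : 0 ≤ R / y)
      linarith
    refine ⟨⌈R / y⌉₊, Nat.one_le_ceil_iff.2 (by positivity), ?_⟩
    set N := ⌈R / y⌉₊
    have h1 : τ * B * (N / R * T) ≤ 2 * B * X := by
      calc τ * B * (N / R * T) ≤ τ * B * (2 * (R / y) / R * T) := by gcongr
        _ = 2 * B * (τ * T / y) := by field_simp
        _ = 2 * B * X := by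
          have : (τ : ℝ) * T = n * y ^ 3 := by rw [hy3]; field_simp
          rw [this, hXy]
          field_simp
    have h2 : n * (κ / (N : ℝ) ^ 2) ≤ κ / R ^ 2 * X := by
      calc n * (κ / (N : ℝ) ^ 2) ≤ n * (κ / (R / y) ^ 2) := by gcongr
        _ = κ / R ^ 2 * X := by rw [hXy]; field_simp
    calc _ ≤ (2 * B + κ / R ^ 2) * X := by linarith
      _ ≤ (2 * B + κ + κ / R ^ 2) * X := by gcongr; linarith
      _ ≤ _ := by
        gcongr
        exact le_max_left _ _

/-- When the optimal mesh exceeds the radius `R`, the claimed bound is of order `n`. -/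
lemma mul_le_of_lt_mul {T R : ℝ} {n τ : ℕ} (hR : 0 < R) (hT : 0 ≤ T)
    (hTn : n * R ^ 3 ≤ τ * T) :
    R ^ 2 * n ≤ (τ : ℝ) ^ (2 / 3 : ℝ) * (n : ℝ) ^ (1 / 3 : ℝ) * T ^ (2 / 3 : ℝ) := by
  have h1 : (n * R ^ 3 : ℝ) ^ (2 / 3 : ℝ) ≤ (τ * T : ℝ) ^ (2 / 3 : ℝ) :=
    Real.rpow_le_rpow (by positivity) hTn (by norm_num)
  rw [Real.mul_rpow (by positivity) (by positivity), Real.mul_rpow (by positivity) hT] at h1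
  have h2 : (R ^ 3) ^ (2 / 3 : ℝ) = R ^ 2 := by
    rw [← Real.rpow_natCast, ← Real.rpow_mul hR.le, ← Real.rpow_natCast]
    norm_num
  have h3 : (n : ℝ) = (n : ℝ) ^ (1 / 3 : ℝ) * (n : ℝ) ^ (2 / 3 : ℝ) := by
    rw [← Real.rpow_add' (by positivity) (by norm_num)]
    norm_num
  rw [h2] at h1
  calc R ^ 2 * n = (n : ℝ) ^ (1 / 3 : ℝ) * ((n : ℝ) ^ (2 / 3 : ℝ) * R ^ 2) := by
        nth_rewrite 1 [h3]; ring
    _ ≤ (n : ℝ) ^ (1 / 3 : ℝ) * ((τ : ℝ) ^ (2 / 3 : ℝ) * T ^ (2 / 3 : ℝ)) := by gcongr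
    _ = _ := by ring

/-- The constant of the second order cost of dithering. -/
noncomputable def Params.ditherConst (P : Params) : ℝ :=
  P.expConcavity / 2 * (2 * P.G * P.alpha * P.R) ^ 2

/-- The constant of the regret bounds. -/
noncomputable def Params.regretConst (P : Params) : ℝ :=
  3 * P.intervalConst +
    (P.L / 2 + P.ditherConst + P.ditherConst / P.R ^ 2 + P.L / (2 * P.R ^ 2)) / Real.log 2

lemma DelayedRun.static_regret_le (h : DelayedRun D P τ n A b S x) (hP : P.Pos) (hd : 0 < d)
    (hτ : 1 ≤ τ) (hn : 2 ≤ n) (hconv : Convex ℝ D) (hDbox : D ⊆ box d P.R)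
    (hdata : ∀ t ∈ Finset.Icc 1 n, DataBounds P (A t) (b t)) {r s : ℕ} (hr : 1 ≤ r)
    (hs : s ≤ n) {u : Fin d → ℝ} (hu : u ∈ D) :
    ∑ t ∈ Finset.Icc r s, (regressionLoss (A t) (b t) (x t) - regressionLoss (A t) (b t) u) ≤
      τ * (P.intervalConst * (d * √(d : ℝ)) * Real.log n) + τ * (P.L / 2) := by
  obtain ⟨g, hI, hg⟩ := h.exists_interleaved hP hd hτ hconv hDbox hdata
  have hsub : Finset.Icc r s ⊆ Finset.Icc 1 n := Finset.Icc_subset_Icc hr hs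
  refine (Finset.sum_le_sum fun t ht => hg t (hsub ht) u hu).trans ?_
  rw [Finset.sum_add_distrib]
  have hL := hP.L
  refine add_le_add ?_ (sum_late_le (by positivity) τ n hsub)
  have e : Finset.Icc r s = Finset.Ico r (s + 1) := by ext; simp
  rw [e]
  exact hI.sum_Ico_le hP hd hτ hn hr (hDbox hu)

lemma DelayedRun.dynamic_regret_le (h : DelayedRun D P τ n A b S x) (hP : P.Pos) (hd : 0 < d)
    (hτ : 1 ≤ τ) (hn : 2 ≤ n) (hconv : Convex ℝ D) (hDbox : D ⊆ box d P.R)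
    (hdata : ∀ t ∈ Finset.Icc 1 n, DataBounds P (A t) (b t)) {u : ℕ → Fin d → ℝ}
    (hu : ∀ t ∈ Finset.Icc 1 n, u t ∈ D) :
    ∑ t ∈ Finset.Icc 1 n,
        (regressionLoss (A t) (b t) (x t) - regressionLoss (A t) (b t) (u t)) ≤
      P.regretConst * Real.log n * ((d * √(d : ℝ)) *
        max ((τ : ℝ) ^ (2 / 3 : ℝ) * (n : ℝ) ^ (1 / 3 : ℝ) *
          totalVariation n u ^ (2 / 3 : ℝ)) (τ : ℝ)) := by
  have hL := hP.L; have hG := hP.G; have hR := hP.R; have ha := hP.alpha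
  have he := hP.expConcavity_pos
  have hK := hP.intervalConst_pos
  have hd1 : (1 : ℝ) ≤ d := by exact_mod_cast hd
  have hdd : (1 : ℝ) ≤ d * √(d : ℝ) :=
    one_le_mul_of_one_le_of_one_le hd1 (Real.one_le_sqrt.2 hd1)
  have hn2 : (2 : ℝ) ≤ n := by exact_mod_cast hn
  have hlog2 : 0 < Real.log 2 := Real.log_pos (by norm_num)
  have hlogn : Real.log 2 ≤ Real.log n := Real.log_le_log (by norm_num) hn2
  have hκ : 0 ≤ P.ditherConst := by unfold Params.ditherConst; positivity
  set T := totalVariation n u with hT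
  have hT0 : 0 ≤ T := totalVariation_nonneg n u
  set M := max ((τ : ℝ) ^ (2 / 3 : ℝ) * (n : ℝ) ^ (1 / 3 : ℝ) * T ^ (2 / 3 : ℝ)) (τ : ℝ) with hM
  have hτM : (τ : ℝ) ≤ M := le_max_right _ _
  have hM0 : 0 ≤ M := le_trans (by positivity) hτM
  set Q := (d * √(d : ℝ)) * Real.log n with hQ
  have hQ2 : Real.log 2 ≤ Q := by
    calc Real.log 2 = 1 * Real.log 2 := (one_mul _).symm
      _ ≤ Q := by rw [hQ]; gcongr
  -- Absorbs a constant that comes without the factor `log n`.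
  have habs : ∀ c : ℝ, 0 ≤ c → c * M ≤ c / Real.log 2 * Q * M := by
    intro c hc
    gcongr
    calc c = c / Real.log 2 * Real.log 2 := (div_mul_cancel₀ _ hlog2.ne').symm
      _ ≤ _ := by gcongr
  have hgoal : P.regretConst * Real.log n * ((d * √(d : ℝ)) * M) =
      3 * P.intervalConst * Q * M + P.L / 2 / Real.log 2 * Q * M +
        (P.ditherConst + P.ditherConst / P.R ^ 2) / Real.log 2 * Q * M +
        P.L / (2 * P.R ^ 2) / Real.log 2 * Q * M := by
    rw [Params.regretConst, hQ]; ring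
  have hKQ : 0 ≤ P.intervalConst * Q * M := by positivity
  have a1 := habs (P.L / 2) (by positivity)
  have a2 := habs (P.ditherConst + P.ditherConst / P.R ^ 2) (by positivity)
  have a3 := habs (P.L / (2 * P.R ^ 2)) (by positivity)
  have b1 : 0 ≤ P.L / 2 * M := by positivity
  have b2 : 0 ≤ (P.ditherConst + P.ditherConst / P.R ^ 2) * M := by positivity
  have b3 : 0 ≤ P.L / (2 * P.R ^ 2) * M := by positivity
  rw [hgoal]
  rcases le_total (τ * T) (n * P.R ^ 3) with hcase | hcase
  · obtain ⟨g, hI, hg⟩ := h.exists_interleaved hP hd hτ hconv hDbox hdata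
    obtain ⟨N, hN, hmesh⟩ := exists_mesh (n := n) (τ := τ) (B := P.intervalConst * Q)
      (by omega) hτ hR hκ (by positivity) hT0 hcase
    have h1 := Finset.sum_le_sum fun t ht => hg t ht (u t) (hu t ht)
    rw [Finset.sum_add_distrib] at h1
    have h2 := sum_late_le (c := P.L / 2) (by positivity) τ n (Finset.Subset.refl (Finset.Icc 1 n))
    have h3 := hI.sum_le_totalVariation hP hd hτ hn (fun t ht => hDbox (hu t ht)) hN
    have e1 : P.expConcavity / 2 * (2 * P.G * P.alpha * (P.R / N)) ^ 2 =
        P.ditherConst / (N : ℝ) ^ 2 := by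
      rw [Params.ditherConst]; ring
    have e2 : τ * (P.intervalConst * (d * √(d : ℝ)) * Real.log n) * (1 + N / P.R * T) =
        τ * (P.intervalConst * Q) + τ * (P.intervalConst * Q) * (N / P.R * T) := by
      rw [hQ]; ring
    rw [e1, e2] at h3
    have h4 : τ * (P.intervalConst * Q) ≤ P.intervalConst * Q * M := by
      rw [mul_comm]; gcongr
    have h5 : τ * (P.L / 2) ≤ P.L / 2 * M := by rw [mul_comm]; gcongr
    have h6 : (2 * (P.intervalConst * Q) + P.ditherConst + P.ditherConst / P.R ^ 2) * M =
        2 * (P.intervalConst * Q * M) + (P.ditherConst + P.ditherConst / P.R ^ 2) * M := by ring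
    rw [h6] at hmesh
    linarith
  · have h1 : ∑ t ∈ Finset.Icc 1 n,
        (regressionLoss (A t) (b t) (x t) - regressionLoss (A t) (b t) (u t)) ≤
        ∑ _t ∈ Finset.Icc 1 n, P.L / 2 := by
      refine Finset.sum_le_sum fun t ht => ?_
      have h3 := (hdata t ht).loss_bound (x t) (hDbox (h.play t ht).1)
      have h4 := regressionLoss_nonneg (A t) (b t) (u t)
      nlinarith [sq_nonneg P.G]
    have h2 := (mul_le_of_lt_mul hR hT0 hcase).trans (le_max_left _ (τ : ℝ))
    have h3 : n * (P.L / 2) ≤ P.L / (2 * P.R ^ 2) * M := by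
      calc n * (P.L / 2) = P.L / (2 * P.R ^ 2) * (P.R ^ 2 * n) := by field_simp
        _ ≤ _ := by gcongr
    rw [Finset.sum_const, Nat.card_Icc, Nat.add_sub_cancel, nsmul_eq_mul] at h1
    linarith

lemma Params.Pos.regretConst_pos (hP : P.Pos) : 0 < P.regretConst := by
  have hL := hP.L; have hR := hP.R
  have he := hP.expConcavity_pos
  have hK := hP.intervalConst_pos
  have hlog2 : 0 < Real.log 2 := Real.log_pos (by norm_num)
  unfold Params.regretConst Params.ditherConst
  positivity

end Final
end ProDR

theorem theorem2 (α R G L : ℝ) (hα : 0 < α) (hR : 0 < R) (hG : 0 < G) :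
    ∃ (C : ℝ) (k : ℕ), 0 < C ∧
      ∀ (d p n τ : ℕ) (σ χ : ℝ) (D : Set (Fin d → ℝ))
        (A : ℕ → Matrix (Fin p) (Fin d) ℝ) (b : ℕ → Fin p → ℝ)
        (S : ℕ → ℕ → ProDR.State d) (x : ℕ → Fin d → ℝ),
        2 ≤ n → 1 ≤ τ →
        Convex ℝ D → IsCompact D →
        -- bounds on the data and on the decision set
        (∀ t ∈ Finset.Icc 1 n, ∀ i, ProDR.l1Norm (A t i) ≤ α) →
        (∀ t ∈ Finset.Icc 1 n, ProDR.l1Norm (b t) ≤ σ) →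
        (∀ z ∈ D, ProDR.l1Norm z ≤ χ ∧ z ∈ ProDR.box d R) →
        -- the choice of `G` and `L`
        (∀ t ∈ Finset.Icc 1 n, ∀ w₁ ∈ ProDR.box d R, ∀ w₂ ∈ ProDR.box d R,
          ProDR.l1Norm (A t *ᵥ (w₁ + w₂) - (2 : ℝ) • b t) ≤ G) →
        (∀ t ∈ Finset.Icc 1 n, ∀ w ∈ ProDR.box d R,
          2 * ProDR.regressionLoss (A t) (b t) w + 2 * G ^ 2 ≤ L) →
        -- `x 1, …, x n` are the predictions of the delayed algorithm
        ProDR.DelayedRun D { alpha := α, R := R, G := G, L := L } τ n A b S x →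
        -- dynamic regret
        (∀ u : ℕ → Fin d → ℝ, (∀ t ∈ Finset.Icc 1 n, u t ∈ D) →
          ∑ t ∈ Finset.Icc 1 n,
              (ProDR.regressionLoss (A t) (b t) (x t) - ProDR.regressionLoss (A t) (b t) (u t)) ≤
            C * Real.log n ^ k *
              ((d : ℝ) ^ 3 *
                max ((τ : ℝ) ^ (2 / 3 : ℝ) * (n : ℝ) ^ (1 / 3 : ℝ) *
                  ProDR.totalVariation n u ^ (2 / 3 : ℝ)) (τ : ℝ))) ∧
        -- static regret on every interval
        (∀ r s : ℕ, 1 ≤ r → r ≤ s → s ≤ n → ∀ u ∈ D,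
          ∑ t ∈ Finset.Icc r s,
              (ProDR.regressionLoss (A t) (b t) (x t) - ProDR.regressionLoss (A t) (b t) u) ≤
            C * ((d : ℝ) ^ (3 / 2 : ℝ) * (τ : ℝ) * Real.log n)) := by
  -- The bounds at `t = 1` force `L > 0`, so the constant for `L ≤ 0` is irrelevant.
  by_cases hL : 0 < L
  swap
  · refine ⟨1, 0, one_pos, ?_⟩
    intro d p n τ σ χ D A b S x hn hτ hconv hcomp hrow hb hDbox hGb hLb hrun
    have h1 := hLb 1 (by simp; omega) 0 (ProDR.zero_mem_box hR.le)
    have h2 := ProDR.regressionLoss_nonneg (A 1) (b 1) 0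
    nlinarith [pow_pos hG 2]
  set P : ProDR.Params := { alpha := α, R := R, G := G, L := L } with hPdef
  have hP : P.Pos := ⟨hα, hR, hG, hL⟩
  refine ⟨P.regretConst, 1, hP.regretConst_pos, ?_⟩
  intro d p n τ σ χ D A b S x hn hτ hconv _ hrow _ hDbox hGb hLb hrun
  rcases Nat.eq_zero_or_pos d with rfl | hd
  · -- In dimension zero the only comparator is the play itself.
    have e : ∀ (t : ℕ) (u : Fin 0 → ℝ), ProDR.regressionLoss (A t) (b t) (x t) -
        ProDR.regressionLoss (A t) (b t) u = 0 := fun t u => by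
      rw [Subsingleton.elim (x t) u, sub_self]
    simp [e]
  have hDb : D ⊆ ProDR.box d P.R := fun z hz => (hDbox z hz).2
  have hdata : ∀ t ∈ Finset.Icc 1 n, ProDR.DataBounds P (A t) (b t) := fun t ht =>
    ⟨hrow t ht, hGb t ht, hLb t ht⟩
  have hd1 : (1 : ℝ) ≤ d := by exact_mod_cast hd
  have hlog2 : 0 < Real.log 2 := Real.log_pos (by norm_num)
  have hlogn : Real.log 2 ≤ Real.log n := Real.log_le_log (by norm_num) (by exact_mod_cast hn)
  constructor
  · intro u hu
    refine (hrun.dynamic_regret_le hP hd hτ hn hconv hDb hdata hu).trans ?_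
    rw [pow_one]
    have hC := hP.regretConst_pos
    have hdd : (d : ℝ) * √(d : ℝ) ≤ (d : ℝ) ^ 3 := by
      have : √(d : ℝ) ≤ (d : ℝ) ^ 2 := by
        rw [Real.sqrt_le_left (by positivity), ← pow_mul]
        exact le_self_pow₀ hd1 (by norm_num)
      calc (d : ℝ) * √(d : ℝ) ≤ d * d ^ 2 := by gcongr
        _ = _ := by ring
    gcongr
  · intro r s hr _ hs u hu
    refine (hrun.static_regret_le hP hd hτ hn hconv hDb hdata hr hs hu).trans ?_
    have e : (d : ℝ) ^ (3 / 2 : ℝ) = d * √(d : ℝ) := by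
      rw [Real.sqrt_eq_rpow, ← Real.rpow_one_add' (by positivity) (by norm_num)]
      norm_num
    rw [e]
    have hdd : (1 : ℝ) ≤ d * √(d : ℝ) :=
      one_le_mul_of_one_le_of_one_le hd1 (Real.one_le_sqrt.2 hd1)
    set Q := (d * √(d : ℝ)) * Real.log n with hQ
    have hQ2 : Real.log 2 ≤ Q := by
      calc Real.log 2 = 1 * Real.log 2 := (one_mul _).symm
        _ ≤ Q := by rw [hQ]; gcongr
    have hK := hP.intervalConst_pos
    have hκ : 0 ≤ P.ditherConst + P.ditherConst / P.R ^ 2 + P.L / (2 * P.R ^ 2) := by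
      have := hP.expConcavity_pos
      have := hP.L
      unfold ProDR.Params.ditherConst
      positivity
    have h1 : P.L / 2 ≤ (P.L / 2 + P.ditherConst + P.ditherConst / P.R ^ 2 +
        P.L / (2 * P.R ^ 2)) / Real.log 2 * Q := by
      have hL' : 0 < P.L := hP.L
      set Y := P.ditherConst + P.ditherConst / P.R ^ 2 + P.L / (2 * P.R ^ 2)
      calc P.L / 2 = P.L / 2 / Real.log 2 * Real.log 2 := (div_mul_cancel₀ _ hlog2.ne').symm
        _ ≤ (P.L / 2 + Y) / Real.log 2 * Q := by gcongr; linarith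
        _ = _ := by simp only [Y]; ring
    calc _ = τ * (P.intervalConst * Q + P.L / 2) := by rw [hQ]; ring
      _ ≤ τ * (P.regretConst * Q) := by
        gcongr
        rw [ProDR.Params.regretConst, add_mul]
        have : 0 ≤ P.intervalConst * Q := by
          have : 0 ≤ Q := hlog2.le.trans hQ2
          positivity
        linarith
      _ = _ := by rw [hQ]; ring
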